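/- Let $\lambda\in\mathbb N$ be the security parameter. Let $N=N(\lambda)$ (the number of users) be bounded by a polynomial in $\lambda$, let $\mathcal S=\mathcal S(\lambda)\subseteq[N]$ be a nonempty set of $n=n(\lambda)$ servers, let $L=L(\lambda)\in\mathbb N$, and let $\mathcal M=\mathcal M(\lambda)$ be a message space. An input is a pair $\sigma=((m_i)_{i\in[N]},\pi)$ with $m_i\in\mathcal M$ and $\pi$ a permutation of $[N]$: user $i$ wants to send the single message $m_i$ to user $\pi(i)$. The protocol $\Pi_p$ on input $\sigma$: every user $i$ chooses servers $T^i_1,\dots,T^i_L$ independently and uniformly at random from $\mathcal S$ (independently of the other users), and forms an onion with message $m_i$ and routing path $(T^i_1,\dots,T^i_L,\pi(i))$. The protocol has $L+1$ synchronous rounds. In round $1$ every user sends its onion to the first party on the onion's path; in every later round each party peels the onions that it received in the previous round and sends each resulting onion, in random order, to its next destination. Encryption is ideal, so a network adversary observes exactly the traffic volumes: for every round and every ordered pair $(a,b)\in[N]^2$ the number of onions sent from $a$ to $b$ in that round. For a network adversary $\mathcal A$, its view $V^{\Pi_p,\mathcal A}(\sigma)$ consists of all these traffic volumes together with the adversary's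 own randomness, which is independent of the execution. Theorem. If $\frac{N}{n}=\Omega(\log^2\lambda)$ and $L=\Omega(\log^2\lambda)$, then $\Pi_p$ is statistically private from the network adversary: for every network adversary $\mathcal A$ and all inputs $\sigma_0=\sigma_0(\lambda)$, $\sigma_1=\sigma_1(\lambda)$, the total variation distance \[ \Delta\bigl(V^{\Pi_p,\mathcal A}(\sigma_0),V^{\Pi_p,\mathcal A}(\sigma_1)\bigr) \] is negligible in $\lambda$, i.e. it is $O(\lambda^{-c})$ for every $c>0$. -/

import Mathlib

open Filter Asymptotics MeasureTheory

universe u v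

/-- Idealized onions addressed to parties in `P` and carrying messages in `M`: either the innermost
onion, which reveals the message, or a layer, which reveals the next destination and the peeled
onion. Encryption is ideal: nothing about the contents of an onion enters what is observed. -/
inductive Onion (P M : Type*) where
  | payload (m : M) : Onion P M
  | layer (next : P) (inner : Onion P M) : Onion P M

/-- Wrap the message `m` for the routing path given as a list of parties, first hop outermost. -/
def formOnion {P M : Type*} (m : M) : List P → Onion P M
  | [] => Onion.payload m
  | p :: path => Onion.layer p (formOnion m path)

/-- Peel one layer: the result is the message, or the next destination with the peeled onion. -/
def procOnion {P M : Type*} : Onion P M → M ⊕ (P × Onion P M)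
  | Onion.payload m => Sum.inl m
  | Onion.layer p o => Sum.inr (p, o)

/-- One onion in transit on the link from `src` to `dst`. -/
structure Packet (P M : Type*) where
  src : P
  dst : P
  onion : Onion P M

/-- Party `a` peels the onion `o` and sends the result to the next destination, if there is one. -/
def forward {P M : Type*} (a : P) (o : Onion P M) : Option (Packet P M) :=
  match procOnion o with
  | Sum.inl _ => none
  | Sum.inr (b, o') => some ⟨a, b, o'⟩

/-- Inputs of the simple input-output setting: user `i` wants to send the one message `msg i` to
user `recipient i`, and `recipient` is a permutation of the users. -/
structure SimpleInput (N : ℕ) (M : Type*) where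
  msg : Fin N → M
  recipient : Equiv.Perm (Fin N)

/-- A synchronous execution with `R` rounds: for every round the onions in transit. They form
a multiset: the order in which a party sends its onions within a round carries no information. -/
abbrev Execution (N : ℕ) (M : Type*) (R : ℕ) : Type _ := Fin R → Multiset (Packet (Fin N) M)

/-- Traffic volumes: for every round and every ordered pair of parties the number of onions sent
over that link in that round. -/
abbrev Traffic (N R : ℕ) : Type := Fin R → Fin N → Fin N → ℕ

/-- The traffic volumes of an execution. -/
def trafficOf {N R : ℕ} {M : Type*} (e : Execution N M R) : Traffic N R :=
  fun r a b => (e r).countP fun q => q.src = a ∧ q.dst = b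

/-- A communications protocol in the simple input-output setting, with `N k` users and message
space `M k` at security parameter `k`: the number of rounds and the distribution of the execution
on every input. -/
structure Protocol (N : ℕ → ℕ) (M : ℕ → Type*) where
  rounds : ℕ → ℕ
  run : ∀ k, SimpleInput (N k) (M k) → PMF (Execution (N k) (M k) (rounds k))

/-- A network adversary does not interfere with the execution; all it has of its own is the
randomness that it uses, which is drawn independently of the execution. -/
structure NetworkAdversary where
  Coins : ℕ → Type v
  [measurableSpace : ∀ k, MeasurableSpace (Coins k)]
  law : ∀ k, Measure (Coins k)
  [isProbabilityMeasure : ∀ k, IsProbabilityMeasure (law k)]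

attribute [instance] NetworkAdversary.measurableSpace NetworkAdversary.isProbabilityMeasure

/-- The distribution of the view of a network adversary at security parameter `k` on input `σ`:
the traffic volumes on all links in all rounds, together with its own randomness. -/
noncomputable def networkView {N : ℕ → ℕ} {M : ℕ → Type*} (prot : Protocol N M)
    (A : NetworkAdversary) (k : ℕ) (σ : SimpleInput (N k) (M k)) :
    Measure (Traffic (N k) (prot.rounds k) × A.Coins k) :=
  ((prot.run k σ).map trafficOf).toMeasure.prod (A.law k)

/-- Statistical distance (total variation distance) of two probability measures. -/
noncomputable def statDist {Ω : Type*} [MeasurableSpace Ω] (μ ν : Measure Ω) : ℝ :=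
  ⨆ E : {E : Set Ω // MeasurableSet E}, |μ.real E.1 - ν.real E.1|

/-- A function of the security parameter is negligible if it decays faster than the inverse of
every polynomial. -/
def Negligible (f : ℕ → ℝ) : Prop :=
  SuperpolynomialDecay atTop (fun k : ℕ => (k : ℝ)) f

/-- Statistical privacy from the network adversary. No party is monitored or corrupted, so the
inputs may differ arbitrarily. -/
def StatisticallyPrivateFromNetwork {N : ℕ → ℕ} {M : ℕ → Type u} (prot : Protocol N M) : Prop :=
  ∀ A : NetworkAdversary.{v}, ∀ σ₀ σ₁ : ∀ k, SimpleInput (N k) (M k),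
    Negligible fun k => statDist (networkView prot A k (σ₀ k)) (networkView prot A k (σ₁ k))

/-- First round: user `i` forms an onion for the routing path `T i 0, …, T i (L - 1), recipient i`
and sends it to the first party on this path. -/
def firstRound {N L : ℕ} {M : Type*} (σ : SimpleInput N M) (T : Fin N → Fin L → Fin N) :
    Multiset (Packet (Fin N) M) :=
  (Finset.univ : Finset (Fin N)).val.filterMap fun i =>
    forward i (formOnion (σ.msg i) (List.ofFn (T i) ++ [σ.recipient i]))

/-- Every party peels the onions that it has just received and sends the results on. -/
def nextRound {N : ℕ} {M : Type*} (s : Multiset (Packet (Fin N) M)) :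
    Multiset (Packet (Fin N) M) :=
  s.filterMap fun q => forward q.dst q.onion

/-- The execution with `L + 1` rounds determined by the input and the chosen mix-nodes. -/
def onionExecution {N L : ℕ} {M : Type*} (σ : SimpleInput N M) (T : Fin N → Fin L → Fin N) :
    Execution N M (L + 1) :=
  fun r => nextRound^[(r : ℕ)] (firstRound σ T)

/-- The onion routing protocol: every user chooses `L k` mix-nodes, independently and uniformly at
random from the nonempty set of servers (a uniform element of the set of all choices of all users),
and the onions are routed accordingly. -/
noncomputable def onionProtocol (N L : ℕ → ℕ) (M : ℕ → Type*)
    (servers : ∀ k, Finset (Fin (N k))) (hservers : ∀ k, (servers k).Nonempty) :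
    Protocol N M where
  rounds k := L k + 1
  run k σ :=
    haveI : Nonempty (servers k) := (hservers k).to_subtype
    (PMF.uniformOfFintype (Fin (N k) → Fin (L k) → servers k)).map fun T =>
      onionExecution σ fun i t => (T i t : Fin (N k))

/-! The traffic reveals the first layer of servers by sender, the hop counts between consecutive
layers, and the last layer by recipient. Hop counts do not change when both layers are relabelled by
the same permutation. Hence the observations have the same law in another model: `N` slots, not
users, draw the servers, and after each layer but the last the contents of slots with the same
server are shuffled uniformly (`sum_mul_expect_layers`). The recipients matter only through the
final arrangement of users in slots. It suffices that this arrangement, given the slot assignments,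
is nearly uniform on average (`abs_expect_layers_sub_le`).

Distance from uniform is measured by relative entropy. One layer contracts it in mean by `1 - κ /
4`, provided `κ * log N ≤ log r - 3` and `N ≥ 4 * r * (n + 1)`
(`expect_relEntropy_cosetAverage_le`). To see this, reveal the slots one at a time. The chain rule
splits the relative entropy into deficits of single slots (`sum_slotDeficit`), and the entropy lost
by shuffling fixed blocks telescopes along the same order (`sum_stageGain_le`). For a random order
of the slots, a block with `r` unrevealed slots shrinks the deviation of the next content's
conditional law from uniform by a factor at most `1 / r`, which gains a fraction `κ` of the deficit
(`entropy_gain`, `mul_slotDeficit_le_smoothGain`). By pigeonhole every server assignment contains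
enough disjoint single-server groups of `2 * r` slots, and four placements of such blocks serve
every slot; hence the 4.

The relative entropy starts at `log N!`, and a Pinsker-type bound turns its decay into total
variation. As `log N = O(log λ)`, a large constant `r` allows `κ = K / (d * log λ)` with `K` as
large as desired. Then `L = Ω(log² λ)` layers give a decay faster than any prescribed power of `λ`.
-/

open scoped BigOperators

/-! ### Data processing for finite mass functions. -/

section FiniteEntropy

variable {Ω α : Type*} [Fintype Ω]

/-- The negative Shannon entropy of a mass function. -/
noncomputable def negEntropy (f : Ω → ℝ) : ℝ := ∑ v, f v * Real.log (f v)

open scoped Classical in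
/-- The mass of the fibre of `X` through `v`. -/
noncomputable def fibreMass (X : Ω → α) (f : Ω → ℝ) (v : Ω) : ℝ :=
  ∑ w with X w = X v, f w

theorem le_fibreMass {X : Ω → α} {f : Ω → ℝ} (hf : ∀ v, 0 ≤ f v) (v : Ω) :
    f v ≤ fibreMass X f v :=
  Finset.single_le_sum (f := f) (fun w _ => hf w) (by simp)

theorem fibreMass_nonneg {X : Ω → α} {f : Ω → ℝ} (hf : ∀ v, 0 ≤ f v) (v : Ω) :
    0 ≤ fibreMass X f v :=
  Finset.sum_nonneg fun w _ => hf w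

theorem fibreMass_congr {X : Ω → α} {f : Ω → ℝ} {v w : Ω} (h : X v = X w) :
    fibreMass X f v = fibreMass X f w := by
  unfold fibreMass
  exact Finset.sum_congr (by ext; simp [h]) fun _ _ => rfl

/-- The weights `h v / fibreMass X h v` form the conditional law on a fibre and sum to 1 there. Only
an inequality remains because a fibre with `h`-mass 0 contributes 0. -/
theorem sum_mul_div_fibreMass_le (X : Ω → α) {g : Ω → ℝ} (hg : ∀ v, 0 ≤ g v) (h : Ω → ℝ) :
    ∑ v, h v * fibreMass X g v / fibreMass X h v ≤ ∑ v, g v := by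
  classical
  have h1 : ∑ v, h v * fibreMass X g v / fibreMass X h v
      = ∑ w, ∑ v with X v = X w, h v * g w / fibreMass X h w := by
    simp only [fibreMass, Finset.mul_sum, Finset.sum_div, Finset.sum_filter]
    rw [Finset.sum_comm]
    refine Finset.sum_congr rfl fun w _ => Finset.sum_congr rfl fun v _ => ?_
    by_cases hvw : X v = X w
    · simp [hvw]
    · simp [hvw, Ne.symm hvw]
  rw [h1]
  refine Finset.sum_le_sum fun w _ => ?_
  rw [← Finset.sum_div, ← Finset.sum_mul]
  change fibreMass X h w * g w / fibreMass X h w ≤ g w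
  rcases eq_or_ne (fibreMass X h w) 0 with h0 | h0
  · simp [h0, hg w]
  · rw [mul_div_assoc, mul_div_cancel₀ _ h0]

/-- Relative entropy does not increase when only a function of the outcome is observed. -/
theorem relEntropy_fibreMass_le (X : Ω → α) {g h : Ω → ℝ} (hg : ∀ v, 0 ≤ g v)
    (hh : ∀ v, 0 ≤ h v) (hgh : ∀ v, h v = 0 → g v = 0) :
    ∑ v, g v * (Real.log (fibreMass X g v) - Real.log (fibreMass X h v)) ≤
      ∑ v, g v * (Real.log (g v) - Real.log (h v)) := by
  -- This is `1 - x⁻¹ ≤ log x` at the ratio of the two conditional laws given `X`; the left sides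
  -- have nonnegative sum.
  have key : ∀ v, g v - h v * fibreMass X g v / fibreMass X h v ≤
      g v * (Real.log (g v) - Real.log (h v)) -
        g v * (Real.log (fibreMass X g v) - Real.log (fibreMass X h v)) := by
    intro v
    rcases (hg v).eq_or_lt with h0 | h0
    · rw [← h0]
      have := div_nonneg (mul_nonneg (hh v) (fibreMass_nonneg (X := X) hg v))
        (fibreMass_nonneg (X := X) hh v)
      simpa using this
    · have hhv : 0 < h v := (hh v).lt_of_ne fun h => h0.ne' (hgh v h.symm)
      have hG : 0 < fibreMass X g v := h0.trans_le (le_fibreMass hg v)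
      have hH : 0 < fibreMass X h v := hhv.trans_le (le_fibreMass hh v)
      have hlog := Real.one_sub_inv_le_log_of_pos
        (x := g v * fibreMass X h v / (h v * fibreMass X g v)) (by positivity)
      rw [Real.log_div (by positivity) (by positivity), Real.log_mul h0.ne' hH.ne',
        Real.log_mul hhv.ne' hG.ne'] at hlog
      have := mul_le_mul_of_nonneg_left hlog h0.le
      have e : g v * (1 - (g v * fibreMass X h v / (h v * fibreMass X g v))⁻¹)
          = g v - h v * fibreMass X g v / fibreMass X h v := by
        field_simp
      rw [e] at this
      linarith
  have := Finset.sum_le_sum fun v (_ : v ∈ Finset.univ) => key v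
  rw [Finset.sum_sub_distrib, Finset.sum_sub_distrib] at this
  linarith [sum_mul_div_fibreMass_le X hg h]

end FiniteEntropy

/-! ### Averaging over the cosets of a subgroup. -/

section SubgroupAverage

variable {G : Type*} [Group G] [Fintype G]

open scoped Classical in
/-- The average of a function over the left cosets of a subgroup. -/
noncomputable def cosetAverage (H : Subgroup G) (f : G → ℝ) (v : G) : ℝ := 𝔼 y : H, f (v * y)

theorem cosetAverage_nonneg (H : Subgroup G) {f : G → ℝ} (hf : ∀ v, 0 ≤ f v) (v : G) :
    0 ≤ cosetAverage H f v :=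
  Finset.expect_nonneg fun _ _ => hf _

theorem cosetAverage_mul (H : Subgroup G) (f : G → ℝ) (v : G) {y : G} (hy : y ∈ H) :
    cosetAverage H f (v * y) = cosetAverage H f v := by
  classical
  exact Fintype.expect_equiv (Equiv.mulLeft (⟨y, hy⟩ : H)) _ _ fun z => by simp [mul_assoc]

theorem sum_cosetAverage_mul (H : Subgroup G) (f k : G → ℝ)
    (hk : ∀ v, ∀ y ∈ H, k (v * y) = k v) :
    ∑ v, cosetAverage H f v * k v = ∑ v, f v * k v := by
  classical
  have h1 : ∀ y : H, ∑ v, f (v * y) * k v = ∑ v, f v * k v := fun y =>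
    Fintype.sum_equiv (Equiv.mulRight (y : G)) _ _ fun v => by simp [hk v y y.2]
  simp only [cosetAverage, Finset.expect_mul]
  rw [← Finset.expect_sum_comm]
  simp only [h1]
  exact Finset.expect_const Finset.univ_nonempty _

theorem sum_cosetAverage (H : Subgroup G) (f : G → ℝ) :
    ∑ v, cosetAverage H f v = ∑ v, f v := by
  simpa using sum_cosetAverage_mul H f (fun _ => 1) (fun _ _ _ => rfl)

theorem cosetAverage_eq_zero_of_le {H K : Subgroup G} (hHK : H ≤ K) {f : G → ℝ}
    (hf : ∀ v, 0 ≤ f v) {v : G} (h : cosetAverage K f v = 0) : cosetAverage H f v = 0 := by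
  classical
  have h2 : ∀ y : K, f (v * y) = 0 := by
    simpa [cosetAverage] using
      (Finset.expect_eq_zero_iff_of_nonneg (fun y _ => hf _)).1 h
  exact Finset.expect_eq_zero fun y _ => h2 ⟨y, hHK y.2⟩

/-- What the negative entropy loses when passing to coarser coset averages is at least the
relative entropy of any statistic. -/
theorem le_negEntropy_cosetAverage_sub {α : Type*} (X : G → α) {H K : Subgroup G} (hHK : H ≤ K)
    {f : G → ℝ} (hf : ∀ v, 0 ≤ f v) :
    ∑ v, cosetAverage H f v * (Real.log (fibreMass X (cosetAverage H f) v) -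
        Real.log (fibreMass X (cosetAverage K f) v)) ≤
      negEntropy (cosetAverage H f) - negEntropy (cosetAverage K f) := by
  refine (relEntropy_fibreMass_le X (cosetAverage_nonneg H hf) (cosetAverage_nonneg K hf)
    fun v hv => cosetAverage_eq_zero_of_le hHK hf hv).trans_eq ?_
  -- The logarithm of the `K`-average is invariant under `K`, hence under `H`, so it may be
  -- integrated against either average. The entropy difference thus becomes a relative entropy, to
  -- which data processing applies.
  have e : negEntropy (cosetAverage K f)
      = ∑ v, cosetAverage H f v * Real.log (cosetAverage K f v) := by
    rw [negEntropy, sum_cosetAverage_mul K f _ fun v y hy => by rw [cosetAverage_mul K f v hy],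
      sum_cosetAverage_mul H f _ fun v y hy => by rw [cosetAverage_mul K f v (hHK hy)]]
  rw [e, negEntropy, ← Finset.sum_sub_distrib]
  exact Finset.sum_congr rfl fun v _ => by ring

theorem negEntropy_cosetAverage_anti {H K : Subgroup G} (hHK : H ≤ K)
    {f : G → ℝ} (hf : ∀ v, 0 ≤ f v) :
    negEntropy (cosetAverage K f) ≤ negEntropy (cosetAverage H f) := by
  have := le_negEntropy_cosetAverage_sub (fun _ => ()) hHK hf
  simp only [fibreMass, Finset.filter_true, sum_cosetAverage, sub_self, mul_zero,
    Finset.sum_const_zero] at this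
  linarith

theorem cosetAverage_eq_self {H : Subgroup G} (hH : H = ⊥) (f : G → ℝ) :
    cosetAverage H f = f := by
  classical
  funext v
  have h : ∀ y : H, f (v * y) = f v := fun y => by
    rw [Subgroup.mem_bot.1 (show (y : G) ∈ (⊥ : Subgroup G) from hH ▸ y.2), mul_one]
  simp only [cosetAverage, h]
  exact Finset.expect_const Finset.univ_nonempty _

theorem fibreMass_cosetAverage {α : Type*} {X : G → α} {H : Subgroup G}
    (hX : ∀ v, ∀ y ∈ H, X (v * y) = X v) (f : G → ℝ) (v : G) :
    fibreMass X (cosetAverage H f) v = fibreMass X f v := by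
  classical
  have := sum_cosetAverage_mul H f (fun w => if X w = X v then 1 else 0)
    (fun w y hy => by rw [hX w y hy])
  simpa [fibreMass, Finset.sum_filter] using this

theorem fibreMass_translate {α : Type*} {X : G → α} {y : G} (hX : ∀ v, X (v * y) = X v)
    (f : G → ℝ) (v : G) :
    fibreMass X (fun w => f (w * y)) v = fibreMass X f v := by
  classical
  simp only [fibreMass, Finset.sum_filter]
  exact Fintype.sum_equiv (Equiv.mulRight y) _ _ fun w => by simp [hX]

end SubgroupAverage

/-! ### Shuffling blocks of slots, and the entropy gained slot by slot. -/

section BlockShuffle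

variable {N : ℕ} {β : Type*}

/-- The permutations of the slots that fix the slots before `k` and preserve the labels `b`. -/
def blockSubgroup (k : ℕ) (b : Fin N → β) : Subgroup (Equiv.Perm (Fin N)) where
  carrier := {y | (∀ j : Fin N, (j : ℕ) < k → y j = j) ∧ ∀ j, b (y j) = b j}
  mul_mem' {x y} hx hy := ⟨fun j hj => by simp [hy.1 j hj, hx.1 j hj], fun j => by
    simp [hx.2, hy.2]⟩
  one_mem' := ⟨fun _ _ => rfl, fun _ => rfl⟩
  inv_mem' {x} hx := ⟨fun j hj => by rw [Equiv.Perm.inv_eq_iff_eq, hx.1 j hj], fun j => by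
    rw [← hx.2]; simp⟩

theorem mem_blockSubgroup {k : ℕ} {b : Fin N → β} {y : Equiv.Perm (Fin N)} :
    y ∈ blockSubgroup k b ↔ (∀ j : Fin N, (j : ℕ) < k → y j = j) ∧ ∀ j, b (y j) = b j :=
  Iff.rfl

theorem blockSubgroup_anti (b : Fin N → β) {k l : ℕ} (h : k ≤ l) :
    blockSubgroup l b ≤ blockSubgroup k b :=
  fun _ hy => ⟨fun j hj => hy.1 j (hj.trans_le h), hy.2⟩

open scoped Classical in
/-- The slots from `k` on that carry the same label as `z`. -/
noncomputable def laterBlock (k : ℕ) (b : Fin N → β) (z : Fin N) : Finset (Fin N) :=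
  Finset.univ.filter fun x => k ≤ (x : ℕ) ∧ b x = b z

theorem mem_laterBlock {k : ℕ} {b : Fin N → β} {x z : Fin N} :
    x ∈ laterBlock k b z ↔ k ≤ (x : ℕ) ∧ b x = b z := by
  simp [laterBlock]

theorem self_mem_laterBlock {k : ℕ} (b : Fin N → β) {z : Fin N} (hz : k ≤ (z : ℕ)) :
    z ∈ laterBlock k b z :=
  mem_laterBlock.2 ⟨hz, rfl⟩

theorem le_apply_of_mem_blockSubgroup {k : ℕ} {b : Fin N → β} {y : Equiv.Perm (Fin N)}
    (hy : y ∈ blockSubgroup k b) {x : Fin N} (hx : k ≤ (x : ℕ)) : k ≤ (y x : ℕ) := by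
  by_contra! h
  have := hy.1 _ h
  rw [y.injective this] at h
  omega

theorem apply_mem_laterBlock {k : ℕ} {b : Fin N → β} {y : Equiv.Perm (Fin N)}
    (hy : y ∈ blockSubgroup k b) {x z : Fin N} (hx : x ∈ laterBlock k b z) :
    y x ∈ laterBlock k b z := by
  rw [mem_laterBlock] at hx ⊢
  exact ⟨le_apply_of_mem_blockSubgroup hy hx.1, (hy.2 x).trans hx.2⟩

theorem swap_mem_blockSubgroup {k : ℕ} {b : Fin N → β} {x z : Fin N} (hz : k ≤ (z : ℕ))
    (hx : x ∈ laterBlock k b z) : Equiv.swap z x ∈ blockSubgroup k b := by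
  rw [mem_laterBlock] at hx
  refine ⟨fun j hj => Equiv.swap_apply_of_ne_of_ne ?_ ?_, fun j => ?_⟩
  · rintro rfl; omega
  · rintro rfl; omega
  · rcases eq_or_ne j z with rfl | h1
    · simp [hx.2]
    · rcases eq_or_ne j x with rfl | h2
      · simp [hx.2]
      · rw [Equiv.swap_apply_of_ne_of_ne h1 h2]

open scoped Classical in
/-- A uniform element of the group moves a slot to a uniform slot of its block. -/
theorem expect_blockSubgroup_apply {k : ℕ} (b : Fin N → β) {z : Fin N} (hz : k ≤ (z : ℕ))
    (φ : Fin N → ℝ) :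
    𝔼 y : blockSubgroup k b, φ ((y : Equiv.Perm (Fin N)) z) = 𝔼 x ∈ laterBlock k b z, φ x := by
  -- Transpositions inside the block make all its slots equivalent, so one may average over the
  -- block as well; each fixed `y` then merely permutes the block.
  have h1 : ∀ x ∈ laterBlock k b z, 𝔼 y : blockSubgroup k b, φ ((y : Equiv.Perm (Fin N)) z) =
      𝔼 y : blockSubgroup k b, φ ((y : Equiv.Perm (Fin N)) x) := fun x hx =>
    Fintype.expect_equiv (Equiv.mulRight ⟨_, swap_mem_blockSubgroup hz hx⟩) _ _ fun y => by simp
  have h2 : ∀ y : blockSubgroup k b,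
      𝔼 x ∈ laterBlock k b z, φ ((y : Equiv.Perm (Fin N)) x) = 𝔼 x ∈ laterBlock k b z, φ x :=
    fun y => Finset.expect_nbij' (fun x => (y : Equiv.Perm (Fin N)) x)
      (fun x => (y⁻¹ : blockSubgroup k b).1 x)
      (fun x hx => apply_mem_laterBlock y.2 hx)
      (fun x hx => apply_mem_laterBlock (y⁻¹).2 hx) (by simp) (by simp) (by simp)
  rw [← Finset.expect_const (s := laterBlock k b z) ⟨z, self_mem_laterBlock b hz⟩
    (𝔼 y : blockSubgroup k b, φ ((y : Equiv.Perm (Fin N)) z)), Finset.expect_congr rfl h1,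
    Finset.expect_comm]
  simp only [h2]
  exact Finset.expect_const Finset.univ_nonempty _

open scoped Classical in
theorem expect_blockSubgroup_inv_apply {k : ℕ} (b : Fin N → β) {z : Fin N} (hz : k ≤ (z : ℕ))
    (φ : Fin N → ℝ) :
    𝔼 y : blockSubgroup k b, φ ((y : Equiv.Perm (Fin N))⁻¹ z) =
      𝔼 x ∈ laterBlock k b z, φ x := by
  rw [← expect_blockSubgroup_apply b hz]
  exact Fintype.expect_equiv (Equiv.inv _) _ _ fun y => by simp

/-- The contents of the slots before `k`. -/
def slotPrefix (k : ℕ) (v : Equiv.Perm (Fin N)) : {j : Fin N // (j : ℕ) < k} → Fin N :=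
  fun j => v j

theorem slotPrefix_eq_iff {k : ℕ} {v w : Equiv.Perm (Fin N)} :
    slotPrefix k v = slotPrefix k w ↔ ∀ j : Fin N, (j : ℕ) < k → v j = w j := by
  simp [slotPrefix, funext_iff]

theorem slotPrefix_succ_eq_iff {k : Fin N} {v w : Equiv.Perm (Fin N)} :
    slotPrefix (k + 1) v = slotPrefix (k + 1) w ↔
      slotPrefix k v = slotPrefix k w ∧ v k = w k := by
  simp only [slotPrefix_eq_iff]
  refine ⟨fun h => ⟨fun j hj => h j (by omega), h k (by omega)⟩, fun h j hj => ?_⟩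
  rcases eq_or_ne j k with rfl | hne
  · exact h.2
  · exact h.1 j (by have := Fin.val_ne_of_ne hne; omega)

theorem slotPrefix_mul_of_mem {k : ℕ} {b : Fin N → β} {y : Equiv.Perm (Fin N)}
    (hy : y ∈ blockSubgroup k b) (v : Equiv.Perm (Fin N)) :
    slotPrefix k (v * y) = slotPrefix k v :=
  slotPrefix_eq_iff.2 fun j hj => by simp [hy.1 j hj]

/-- The mass of the arrangements with the first `k` slots filled. -/
noncomputable abbrev prefixMass (k : ℕ) (f : Equiv.Perm (Fin N) → ℝ) (v : Equiv.Perm (Fin N)) :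
    ℝ :=
  fibreMass (slotPrefix k) f v

open scoped Classical in
/-- The mass of the arrangements that agree with `v` before slot `k` and have in slot `z` what
`v` has in slot `k`. -/
noncomputable def matchMass (k : Fin N) (f : Equiv.Perm (Fin N) → ℝ) (v : Equiv.Perm (Fin N))
    (z : Fin N) : ℝ :=
  ∑ w with slotPrefix k w = slotPrefix k v ∧ w z = v k, f w

theorem matchMass_self (k : Fin N) (f : Equiv.Perm (Fin N) → ℝ) (v : Equiv.Perm (Fin N)) :
    matchMass k f v k = prefixMass (k + 1) f v := by
  unfold matchMass prefixMass fibreMass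
  exact Finset.sum_congr (by ext w; simp [slotPrefix_succ_eq_iff]) fun _ _ => rfl

theorem matchMass_nonneg (k : Fin N) {f : Equiv.Perm (Fin N) → ℝ} (hf : ∀ v, 0 ≤ f v)
    (v : Equiv.Perm (Fin N)) (z : Fin N) : 0 ≤ matchMass k f v z :=
  Finset.sum_nonneg fun w _ => hf w

theorem matchMass_congr {k : Fin N} (f : Equiv.Perm (Fin N) → ℝ) {v w : Equiv.Perm (Fin N)}
    (h : slotPrefix (k + 1) v = slotPrefix (k + 1) w) (z : Fin N) :
    matchMass k f v z = matchMass k f w z := by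
  rw [slotPrefix_succ_eq_iff] at h
  unfold matchMass
  exact Finset.sum_congr (by ext; simp [h.1, h.2]) fun _ _ => rfl

theorem matchMass_translate {k : Fin N} (f : Equiv.Perm (Fin N) → ℝ) {y : Equiv.Perm (Fin N)}
    {b : Fin N → β} (hy : y ∈ blockSubgroup (k : ℕ) b) (v : Equiv.Perm (Fin N)) (z : Fin N) :
    matchMass k (fun w => f (w * y)) v z = matchMass k f v (y⁻¹ z) := by
  classical
  simp only [matchMass, Finset.sum_filter]
  exact Fintype.sum_equiv (Equiv.mulRight y) _ _ fun w => by
    simp [slotPrefix_mul_of_mem hy]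

/-- The shuffle leaves the slots before `k` alone and fills slot `k` from a uniform slot of the rest
of its block. -/
theorem prefixMass_cosetAverage (k : Fin N) (b : Fin N → β) (f : Equiv.Perm (Fin N) → ℝ)
    (v : Equiv.Perm (Fin N)) :
    prefixMass (k + 1) (cosetAverage (blockSubgroup k b) f) v =
      𝔼 z ∈ laterBlock k b k, matchMass k f v z := by
  classical
  rw [← expect_blockSubgroup_inv_apply b le_rfl, ← matchMass_self]
  simp only [matchMass, cosetAverage]
  rw [← Finset.expect_sum_comm]
  refine Finset.expect_congr rfl fun y _ => ?_
  have := matchMass_translate f y.2 v k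
  simpa only [matchMass] using this

/-- The entropy gained by shuffling blocks when slot `k` is revealed. -/
noncomputable def stageGain (k : Fin N) (b : Fin N → β) (f : Equiv.Perm (Fin N) → ℝ) : ℝ :=
  ∑ v, f v * (Real.log (prefixMass (k + 1) f v) -
    Real.log (𝔼 z ∈ laterBlock k b k, matchMass k f v z))

/-- Data processing for the contents of the slots up to `k`: the finer group fixes these slots and
keeps their law, the coarser one mixes slot `k` with its block. -/
theorem stageGain_le (k : Fin N) (b : Fin N → β) {f : Equiv.Perm (Fin N) → ℝ}
    (hf : ∀ v, 0 ≤ f v) :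
    stageGain k b f ≤ negEntropy (cosetAverage (blockSubgroup (k + 1) b) f) -
      negEntropy (cosetAverage (blockSubgroup k b) f) := by
  refine le_trans (le_of_eq ?_) (le_negEntropy_cosetAverage_sub (slotPrefix (k + 1))
    (blockSubgroup_anti b (Nat.le_succ k)) hf)
  have h1 : ∀ v, fibreMass (slotPrefix (k + 1)) (cosetAverage (blockSubgroup (k + 1) b) f) v =
      prefixMass (k + 1) f v :=
    fibreMass_cosetAverage (fun v y hy => slotPrefix_mul_of_mem hy v) f
  have h2 := prefixMass_cosetAverage k b f
  simp only [prefixMass] at h2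
  simp only [h1, h2]
  rw [sum_cosetAverage_mul]
  · rfl
  · intro v y hy
    have e := slotPrefix_mul_of_mem hy v
    rw [prefixMass, fibreMass_congr e,
      Finset.expect_congr rfl fun z _ => matchMass_congr f e z]

/-- The entropies telescope along the chain of block subgroups, which ends at the trivial group. -/
theorem sum_stageGain_le (b : Fin N → β) {f : Equiv.Perm (Fin N) → ℝ} (hf : ∀ v, 0 ≤ f v) :
    ∑ k, stageGain k b f ≤ negEntropy f - negEntropy (cosetAverage (blockSubgroup 0 b) f) := by
  have hbot : blockSubgroup N b = ⊥ := by
    refine le_bot_iff.1 fun y hy => ?_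
    exact Subgroup.mem_bot.2 (Equiv.ext fun j => hy.1 j j.2)
  have e : negEntropy f = negEntropy (cosetAverage (blockSubgroup N b) f) := by
    rw [cosetAverage_eq_self hbot]
  rw [e, ← Finset.sum_range_sub (fun k => negEntropy (cosetAverage (blockSubgroup k b) f)),
    Finset.sum_range]
  exact Finset.sum_le_sum fun k _ => stageGain_le k b hf

end BlockShuffle

/-! ### Replacing a fixed block by a random one. -/

section Smoothing

theorem expect_log_le_log_expect {ι : Type*} [Fintype ι] [Nonempty ι] {x : ι → ℝ}
    (hx : ∀ i, 0 < x i) : 𝔼 i, Real.log (x i) ≤ Real.log (𝔼 i, x i) := by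
  have h0 : (Fintype.card ι : ℝ) ≠ 0 := by simp
  have := strictConcaveOn_log_Ioi.concaveOn.le_map_sum (t := Finset.univ)
    (w := fun _ : ι => (Fintype.card ι : ℝ)⁻¹) (p := x) (fun _ _ => by positivity)
    (by simp [h0]) (fun i _ => hx i)
  simpa [Fintype.expect_eq_sum_div_card, div_eq_inv_mul, Finset.mul_sum] using this

variable {N : ℕ} {β : Type*}

/-- An arrangement that agrees with `v` before slot `k` has `v k` in exactly one slot, and not in an
earlier one. -/
theorem sum_matchMass_later (k : Fin N) (f : Equiv.Perm (Fin N) → ℝ) (v : Equiv.Perm (Fin N)) :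
    ∑ z with k ≤ z, matchMass k f v z = prefixMass k f v := by
  classical
  simp only [matchMass, prefixMass, fibreMass]
  rw [Finset.sum_congr rfl fun z _ => Finset.sum_filter _ _, Finset.sum_comm, Finset.sum_filter]
  refine Finset.sum_congr rfl fun w _ => ?_
  by_cases h : slotPrefix k w = slotPrefix k v
  · simp only [h, true_and, if_true]
    rw [Finset.sum_eq_single (w⁻¹ (v k))]
    · simp
    · intro z _ hz
      rw [if_neg]
      intro h2
      exact hz (by simp [← h2])
    · intro hk
      simp only [Finset.mem_filter, Finset.mem_univ, true_and, not_le] at hk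
      have := slotPrefix_eq_iff.1 h _ hk
      have h2 : v k = v (w⁻¹ (v k)) := by rw [← this]; simp
      have h3 := v.injective h2
      rw [← h3] at hk
      exact absurd hk (lt_irrefl _)
  · simp [h]

theorem sum_matchMass_gt (k : Fin N) (f : Equiv.Perm (Fin N) → ℝ) (v : Equiv.Perm (Fin N)) :
    ∑ z with k < z, matchMass k f v z = prefixMass k f v - prefixMass (k + 1) f v := by
  classical
  have : (Finset.univ.filter fun z => k ≤ z) = insert k (Finset.univ.filter fun z => k < z) := by
    ext z
    simp [le_iff_eq_or_lt, eq_comm]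
  rw [← sum_matchMass_later, this, Finset.sum_insert (by simp), matchMass_self]
  ring

/-- The average over the random contents of a block of `r` slots, out of `s` remaining slots, of
the mass of the next prefix. -/
noncomputable def smoothMass (r : ℕ) (k : Fin N) (f : Equiv.Perm (Fin N) → ℝ)
    (v : Equiv.Perm (Fin N)) : ℝ :=
  prefixMass (k + 1) f v / r +
    ((r : ℝ) - 1) / (r * ((N : ℝ) - k - 1)) * (prefixMass k f v - prefixMass (k + 1) f v)

/-- The average entropy gain at slot `k` from a random block with `r` remaining slots. -/
noncomputable def smoothGain (r : ℕ) (k : Fin N) (f : Equiv.Perm (Fin N) → ℝ) : ℝ :=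
  ∑ v, f v * (Real.log (prefixMass (k + 1) f v) - Real.log (smoothMass r k f v))

open scoped Classical in
theorem expect_matchMass_gt {k z : Fin N} (hz : k < z) (f : Equiv.Perm (Fin N) → ℝ)
    (v : Equiv.Perm (Fin N)) :
    𝔼 y : blockSubgroup ((k : ℕ) + 1) (fun _ : Fin N => ()),
      matchMass k f v ((y : Equiv.Perm (Fin N))⁻¹ z) =
    (prefixMass k f v - prefixMass (k + 1) f v) / ((N : ℝ) - k - 1) := by
  rw [expect_blockSubgroup_inv_apply _ (by exact hz), ← sum_matchMass_gt,
    Finset.expect_eq_sum_div_card]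
  have e : laterBlock ((k : ℕ) + 1) (fun _ : Fin N => ()) z = Finset.univ.filter fun z => k < z := by
    ext x
    simp [mem_laterBlock]
  rw [e]
  congr 1
  have : (Finset.univ.filter fun z => k < z) = Finset.Ioi k := by ext; simp
  rw [this, Fin.card_Ioi]
  have := k.2
  rw [Nat.cast_sub (by omega), Nat.cast_sub (by omega)]
  push_cast; ring

open scoped Classical in
theorem expect_expect_matchMass (k : Fin N) (b : Fin N → β) (f : Equiv.Perm (Fin N) → ℝ)
    (v : Equiv.Perm (Fin N)) :
    𝔼 y : blockSubgroup ((k : ℕ) + 1) (fun _ : Fin N => ()),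
      𝔼 z ∈ laterBlock k b k, matchMass k f v ((y : Equiv.Perm (Fin N))⁻¹ z) =
    smoothMass (laterBlock k b k).card k f v := by
  rw [Finset.expect_comm, Finset.expect_eq_sum_div_card]
  have hk : k ∈ laterBlock k b k := self_mem_laterBlock b le_rfl
  have h0 : ((laterBlock k b k).card : ℝ) ≠ 0 := by
    exact_mod_cast (Finset.card_pos.2 ⟨k, hk⟩).ne'
  rw [← Finset.add_sum_erase _ _ hk, Finset.sum_congr rfl (g := fun _ =>
    (prefixMass k f v - prefixMass (k + 1) f v) / ((N : ℝ) - k - 1))]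
  · have e : ∀ y : blockSubgroup ((k : ℕ) + 1) (fun _ : Fin N => ()),
        matchMass k f v ((y : Equiv.Perm (Fin N))⁻¹ k) = prefixMass (k + 1) f v := fun y => by
      rw [← matchMass_self, Equiv.Perm.inv_eq_iff_eq.2 (y.2.1 k (Nat.lt_succ_self _)).symm]
    rw [Finset.expect_congr rfl fun y _ => e y, Finset.expect_const Finset.univ_nonempty,
      Finset.sum_const, Finset.card_erase_of_mem hk, nsmul_eq_mul,
      Nat.cast_sub (Finset.card_pos.2 ⟨k, hk⟩), smoothMass]
    -- At the last slot the terms divided by `N - k - 1` are 0 on both sides.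
    rcases eq_or_ne ((N : ℝ) - k - 1) 0 with h1 | h1
    · simp [h1]
    · field_simp
      push_cast
      ring
  · intro z hz
    rw [Finset.mem_erase, mem_laterBlock] at hz
    exact expect_matchMass_gt (lt_of_le_of_ne (by exact hz.2.1) (Ne.symm hz.1)) f v

theorem stageGain_translate (k : Fin N) (b : Fin N → β) (f : Equiv.Perm (Fin N) → ℝ)
    {y : Equiv.Perm (Fin N)} (hy : y ∈ blockSubgroup ((k : ℕ) + 1) (fun _ : Fin N => ())) :
    stageGain k b (fun w => f (w * y)) = ∑ v, f v * (Real.log (prefixMass (k + 1) f v) -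
      Real.log (𝔼 z ∈ laterBlock k b k, matchMass k f v (y⁻¹ z))) := by
  rw [stageGain]
  refine Fintype.sum_equiv (Equiv.mulRight y) _ _ fun v => ?_
  have hy' := blockSubgroup_anti _ (Nat.le_succ k) hy
  have e := slotPrefix_mul_of_mem hy v
  rw [Equiv.coe_mulRight, prefixMass, fibreMass_translate fun v => slotPrefix_mul_of_mem hy v,
    prefixMass, fibreMass_congr e]
  congr 3
  exact Finset.expect_congr rfl fun z _ => by
    rw [matchMass_translate f hy', matchMass_congr f e]

-- Jensen for the concave logarithm: permuting the slots after `k` keeps the prefix masses and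
-- averages the mass over the block to `smoothMass`.
open scoped Classical in
theorem smoothGain_le_expect (k : Fin N) (b : Fin N → β) {f : Equiv.Perm (Fin N) → ℝ}
    (hf : ∀ v, 0 ≤ f v) :
    smoothGain (laterBlock k b k).card k f ≤
      𝔼 y : blockSubgroup ((k : ℕ) + 1) (fun _ : Fin N => ()),
        stageGain k b (fun w => f (w * y)) := by
  rw [Finset.expect_congr rfl fun y _ => stageGain_translate k b f y.2, Finset.expect_sum_comm]
  refine Finset.sum_le_sum fun v _ => ?_
  rw [← Finset.mul_expect, Finset.expect_sub_distrib, Finset.expect_const Finset.univ_nonempty]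
  rcases (hf v).eq_or_lt with h0 | h0
  · simp [← h0]
  refine mul_le_mul_of_nonneg_left (sub_le_sub_left ?_ _) h0.le
  rw [← expect_expect_matchMass]
  refine expect_log_le_log_expect fun y => ?_
  have hk : k ∈ laterBlock k b k := self_mem_laterBlock b le_rfl
  rw [Finset.expect_eq_sum_div_card]
  have hc : (0 : ℝ) < (laterBlock k b k).card := by exact_mod_cast Finset.card_pos.2 ⟨k, hk⟩
  refine div_pos (lt_of_lt_of_le ?_ (Finset.single_le_sum
    (f := fun z => matchMass k f v ((y : Equiv.Perm (Fin N))⁻¹ z))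
    (fun z _ => matchMass_nonneg k hf v _) hk)) hc
  rw [Equiv.Perm.inv_eq_iff_eq.2 (y.2.1 k (Nat.lt_succ_self _)).symm, matchMass_self]
  exact h0.trans_le (le_fibreMass hf v)

/-- Averaged over a random order of the slots, shuffling blocks gains at least the smoothed gain. -/
theorem expect_smoothGain_le (k : Fin N) (b : Fin N → β) {f : Equiv.Perm (Fin N) → ℝ}
    (hf : ∀ v, 0 ≤ f v) :
    𝔼 w : Equiv.Perm (Fin N), smoothGain (laterBlock k b k).card k (fun v => f (v * w)) ≤
      𝔼 w : Equiv.Perm (Fin N), stageGain k b (fun v => f (v * w)) := by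
  classical
  refine (Finset.expect_le_expect fun w _ =>
    smoothGain_le_expect k b (f := fun v => f (v * w)) fun v => hf _).trans_eq ?_
  rw [Finset.expect_comm]
  -- The uniform `w` absorbs the factor `y`.
  have h : ∀ y : blockSubgroup ((k : ℕ) + 1) (fun _ : Fin N => ()),
      𝔼 w : Equiv.Perm (Fin N), stageGain k b (fun v => f (v * y * w)) =
        𝔼 w : Equiv.Perm (Fin N), stageGain k b (fun v => f (v * w)) := fun y =>
    Fintype.expect_equiv (Equiv.mulLeft (y : Equiv.Perm (Fin N))) _ _ fun w => by
      simp [mul_assoc]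
  simp only [h]
  exact Finset.expect_const Finset.univ_nonempty _

end Smoothing

/-! ### Scalar inequalities for the gain at one slot. -/

section ScalarInequalities

theorem one_sub_inv_le_log_sub_log {α u : ℝ} (hα0 : 0 ≤ α) (hα1 : α ≤ 1) (hu : 0 < u) :
    (1 - α) * (1 - u⁻¹) ≤ Real.log u - Real.log (1 + α * (u - 1)) := by
  have hp : 0 < 1 + α * (u - 1) := by
    rcases hα1.eq_or_lt with rfl | h
    · linarith
    · nlinarith [mul_nonneg hα0 hu.le]
  rw [← Real.log_div hu.ne' hp.ne']
  refine le_trans (le_of_eq ?_) (Real.one_sub_inv_le_log_of_pos (div_pos hu hp))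
  field_simp
  ring

/-- With `u = w ^ 2` this is `1 - w⁻¹ ≤ log w` multiplied by `2 * w ^ 2`. It compares Hellinger
distance with relative entropy. -/
theorem sq_sub_one_le_entropy {u : ℝ} (hu : 0 < u) :
    (Real.sqrt u - 1) ^ 2 ≤ u * Real.log u - u + 1 := by
  obtain ⟨w, hw, rfl⟩ : ∃ w : ℝ, 0 < w ∧ u = w ^ 2 :=
    ⟨Real.sqrt u, Real.sqrt_pos.2 hu, (Real.sq_sqrt hu.le).symm⟩
  rw [Real.sqrt_sq hw.le, Real.log_pow]
  have h := mul_le_mul_of_nonneg_left (Real.one_sub_inv_le_log_of_pos hw) (sq_nonneg w)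
  have e : w ^ 2 * (1 - w⁻¹) = w ^ 2 - w := by field_simp
  push_cast
  nlinarith

/-- Mixing with weight `α ≤ 1 / r` towards the mean gains a fraction `κ` of the entropy. -/
theorem entropy_gain {α κ r s u : ℝ} (hr : 20 ≤ r) (hα0 : 0 ≤ α) (hα1 : α ≤ 1 / r)
    (hκ0 : 0 ≤ κ) (hκ1 : κ ≤ 1 / 2) (hκ : κ * Real.log s ≤ Real.log r - 3)
    (hu : 0 < u) (hus : u ≤ s) :
    κ * Real.log u + (1 - α - κ) * (1 - u⁻¹) ≤ Real.log u - Real.log (1 + α * (u - 1)) := by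
  have hα2 : α ≤ 1 / 20 := hα1.trans (one_div_le_one_div_of_le (by norm_num) hr)
  have hp : 0 < 1 + α * (u - 1) := by nlinarith [mul_nonneg hα0 hu.le]
  have hαr : α * r ≤ 1 := by rwa [le_div_iff₀ (by linarith)] at hα1
  suffices h : u * Real.log (1 + α * (u - 1)) - α * (u - 1) ≤
      (1 - κ) * (u * Real.log u - u + 1) by
    have e : u⁻¹ * (u * Real.log (1 + α * (u - 1)) - α * (u - 1)) ≤
      u⁻¹ * ((1 - κ) * (u * Real.log u - u + 1)) := mul_le_mul_of_nonneg_left h (by positivity)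
    have e1 : u⁻¹ * (u * Real.log (1 + α * (u - 1)) - α * (u - 1)) =
      Real.log (1 + α * (u - 1)) - α * (1 - u⁻¹) := by field_simp
    have e2 : u⁻¹ * ((1 - κ) * (u * Real.log u - u + 1)) =
      (1 - κ) * (Real.log u - (1 - u⁻¹)) := by field_simp; ring
    rw [e1, e2] at e
    linarith
  -- For small `u`, `log x ≤ x - 1` leaves `α * (u - 1) ^ 2`. This is at most half of `(√u - 1) ^
  -- 2`, as `2 * (√u + 1) ^ 2 ≤ 4 * (u + 1) ≤ r` and `α * r ≤ 1`; hence `κ ≤ 1 / 2`.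
  rcases le_or_gt (4 * (u + 1)) r with h4 | h4
  · have h1 : u * Real.log (1 + α * (u - 1)) - α * (u - 1) ≤ α * (u - 1) ^ 2 := by
      have := mul_le_mul_of_nonneg_left (Real.log_le_sub_one_of_pos hp) hu.le
      linarith
    have h2 := sq_sub_one_le_entropy hu
    set w := Real.sqrt u with hw
    have hw0 : 0 ≤ w := Real.sqrt_nonneg u
    have hwu : w ^ 2 = u := Real.sq_sqrt hu.le
    have h3 : (u - 1) ^ 2 = (w - 1) ^ 2 * (w + 1) ^ 2 := by rw [← hwu]; ring
    have h5 : 2 * (w + 1) ^ 2 ≤ r := by nlinarith [sq_nonneg (w - 1)]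
    have h6 : α * (w + 1) ^ 2 ≤ 1 / 2 := by nlinarith
    have h7 : α * (u - 1) ^ 2 ≤ 1 / 2 * (w - 1) ^ 2 := by
      rw [h3]; nlinarith [sq_nonneg (w - 1)]
    nlinarith [sq_nonneg (w - 1)]
  -- Now `r < 5 * u`, so `1 + u / r ≤ 6 * u / r ≤ exp 2 * u / r`. The 3 in `hκ` pays for this 2 and
  -- leaves the `-1` needed at the end.
  · have hu4 : 4 < u := by linarith
    have hr0 : 0 < r := by linarith
    have h1 : Real.log (1 + α * (u - 1)) ≤ Real.log (1 + u / r) := by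
      refine Real.log_le_log hp ?_
      have : α * (u - 1) ≤ 1 / r * u := by
        apply mul_le_mul hα1 (by linarith) (by linarith) (by positivity)
      calc 1 + α * (u - 1) ≤ 1 + 1 / r * u := by linarith
        _ = 1 + u / r := by ring
    have h2 : Real.log (1 + u / r) ≤ Real.log u - Real.log r + 2 := by
      have e6 : (6 : ℝ) ≤ Real.exp 2 := by
        have := Real.exp_one_gt_d9
        rw [show (2 : ℝ) = 1 + 1 by norm_num, Real.exp_add]
        nlinarith
      have : 1 + u / r ≤ u / r * Real.exp 2 := by
        have h8 : 1 / 5 ≤ u / r := by rw [le_div_iff₀ hr0]; linarith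
        nlinarith
      calc Real.log (1 + u / r) ≤ Real.log (u / r * Real.exp 2) :=
            Real.log_le_log (by positivity) this
        _ = Real.log u - Real.log r + 2 := by
            rw [Real.log_mul (by positivity) (by positivity), Real.log_div hu.ne' hr0.ne',
              Real.log_exp]
    have h3 : Real.log u ≤ Real.log s := Real.log_le_log hu hus
    have h4 : κ * Real.log u ≤ Real.log r - 3 := (mul_le_mul_of_nonneg_left h3 hκ0).trans hκ
    have h5 : 0 ≤ α * (u - 1) := mul_nonneg hα0 (by linarith)
    have h6 : u * Real.log (1 + α * (u - 1)) ≤ u * ((1 - κ) * Real.log u - 1) :=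
      mul_le_mul_of_nonneg_left (by linarith) hu.le
    nlinarith

end ScalarInequalities

/-! ### Gain against deficit at a single slot. -/

section SlotEntropy

variable {N : ℕ}

/-- The entropy that the content of slot `k` lacks, given the contents of the earlier slots. -/
noncomputable def slotDeficit (k : Fin N) (f : Equiv.Perm (Fin N) → ℝ) : ℝ :=
  ∑ v, f v * (Real.log (prefixMass (k + 1) f v) - Real.log (prefixMass k f v) +
    Real.log ((N : ℝ) - k))

theorem one_le_remaining (k : Fin N) : (1 : ℝ) ≤ (N : ℝ) - k := by
  have : (k : ℝ) + 1 ≤ N := by exact_mod_cast k.2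
  linarith

theorem prefixMass_succ_le (k : Fin N) {f : Equiv.Perm (Fin N) → ℝ} (hf : ∀ v, 0 ≤ f v)
    (v : Equiv.Perm (Fin N)) : prefixMass (k + 1) f v ≤ prefixMass k f v := by
  classical
  refine Finset.sum_le_sum_of_subset_of_nonneg (fun w => ?_) fun w _ _ => hf w
  simp only [Finset.mem_filter, Finset.mem_univ, true_and]
  exact fun h => (slotPrefix_succ_eq_iff.1 h).1

/-- The prefix mass is a sum over the `N - k` slots `z ≥ k`; each term is the next prefix mass of
`f` translated by `swap k z` and contributes at most the total mass. -/
theorem sum_mul_prefixMass_div_le (k : Fin N) {f : Equiv.Perm (Fin N) → ℝ}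
    (hf : ∀ v, 0 ≤ f v) :
    ∑ v, f v * prefixMass k f v / prefixMass (k + 1) f v ≤ ((N : ℝ) - k) * ∑ v, f v := by
  classical
  have h1 : ∀ z : Fin N, k ≤ z →
      ∑ v, f v * matchMass k f v z / prefixMass (k + 1) f v ≤ ∑ v, f v := by
    intro z hz
    have hy : Equiv.swap k z ∈ blockSubgroup (k : ℕ) (fun _ : Fin N => ()) :=
      swap_mem_blockSubgroup le_rfl (mem_laterBlock.2 ⟨hz, rfl⟩)
    have e : ∀ v, matchMass k f v z =
        fibreMass (slotPrefix (k + 1)) (fun w => f (w * Equiv.swap k z)) v := fun v => by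
      rw [← prefixMass, ← matchMass_self, matchMass_translate f hy]
      simp
    simp only [e]
    refine (sum_mul_div_fibreMass_le _ (fun v => hf _) f).trans_eq ?_
    exact Fintype.sum_equiv (Equiv.mulRight (Equiv.swap k z)) _ _ fun v => by simp
  have h2 := Finset.sum_le_sum fun z (hz : z ∈ Finset.univ.filter fun z => k ≤ z) =>
    h1 z (by simpa using hz)
  rw [Finset.sum_comm, Finset.sum_const, nsmul_eq_mul] at h2
  have hc : ((Finset.univ.filter fun z => k ≤ z).card : ℝ) = (N : ℝ) - k := by
    have : (Finset.univ.filter fun z => k ≤ z) = Finset.Ici k := by ext; simp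
    rw [this, Fin.card_Ici, Nat.cast_sub k.2.le]
  rw [hc] at h2
  refine le_trans (le_of_eq (Finset.sum_congr rfl fun v _ => ?_)) h2
  rw [← Finset.sum_div, ← Finset.mul_sum, sum_matchMass_later]

/-- Rewritten around the uniform value, smoothing multiplies the deviation by a single weight, the
`α` of `entropy_gain`. -/
theorem smoothMass_eq (k : Fin N) (f : Equiv.Perm (Fin N) → ℝ) (v : Equiv.Perm (Fin N)) {r : ℕ}
    (hr1 : 1 ≤ r) (hrs : (r : ℝ) ≤ (N : ℝ) - k) :
    smoothMass r k f v = prefixMass k f v / ((N : ℝ) - k) +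
      ((N : ℝ) - k - r) / (r * ((N : ℝ) - k - 1)) *
        (prefixMass (k + 1) f v - prefixMass k f v / ((N : ℝ) - k)) := by
  have hr0 : (r : ℝ) ≠ 0 := by positivity
  have hs := one_le_remaining k
  rcases eq_or_ne ((N : ℝ) - k - 1) 0 with h1 | h1
  · have hs1 : (N : ℝ) - k = 1 := by linarith
    have hr : (r : ℝ) = 1 := le_antisymm (hrs.trans hs1.le) (by exact_mod_cast hr1)
    have h2 := sum_matchMass_gt k f v
    have h3 : (Finset.univ.filter fun z => k < z) = ∅ := by
      refine Finset.filter_eq_empty_iff.2 fun z _ hz => ?_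
      have hN : N = k + 1 := by
        have : (N : ℝ) = ((k + 1 : ℕ) : ℝ) := by push_cast; linarith
        exact_mod_cast this
      have := z.2
      have hz' : (k : ℕ) < z := hz
      omega
    rw [h3, Finset.sum_empty] at h2
    rw [smoothMass, hs1, hr]
    simp
    linarith
  · have h2 : (N : ℝ) - k ≠ 0 := by linarith
    rw [smoothMass]
    field_simp
    ring

/-- Here `u` is the conditional probability of the content of slot `k` divided by its uniform value.
The terms `1 - u⁻¹` have nonnegative mean by `sum_mul_prefixMass_div_le` and are dropped. -/
theorem le_smoothGain {k : Fin N} {f : Equiv.Perm (Fin N) → ℝ} (hf : ∀ v, 0 ≤ f v) {r : ℕ}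
    (hr1 : 1 ≤ r) (hrs : (r : ℝ) ≤ (N : ℝ) - k) {κ α : ℝ}
    (hα : α = ((N : ℝ) - k - r) / (r * ((N : ℝ) - k - 1))) (hακ : α + κ ≤ 1)
    (H : ∀ u : ℝ, 0 < u → u ≤ (N : ℝ) - k →
      0 < 1 + α * (u - 1) ∧
      κ * Real.log u + (1 - α - κ) * (1 - u⁻¹) ≤ Real.log u - Real.log (1 + α * (u - 1))) :
    κ * slotDeficit k f ≤ smoothGain r k f := by
  have hs := one_le_remaining k
  set s := (N : ℝ) - k with hsdef
  have key : ∀ v, κ * (f v * (Real.log (prefixMass (k + 1) f v) - Real.log (prefixMass k f v) +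
      Real.log s)) + (1 - α - κ) * (f v - f v * prefixMass k f v / prefixMass (k + 1) f v / s) ≤
      f v * (Real.log (prefixMass (k + 1) f v) - Real.log (smoothMass r k f v)) := by
    intro v
    rcases (hf v).eq_or_lt with h0 | h0
    · simp [← h0]
    have hq1 : 0 < prefixMass (k + 1) f v := h0.trans_le (le_fibreMass hf v)
    have hq0 : 0 < prefixMass k f v := h0.trans_le (le_fibreMass hf v)
    have hle := prefixMass_succ_le k hf v
    rw [smoothMass_eq k f v hr1 hrs, ← hsdef, ← hα]
    generalize prefixMass (k + 1) f v = a at *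
    generalize prefixMass k f v = c at *
    have hs0 : 0 < s := by linarith
    obtain ⟨hp, hu⟩ := H (s * a / c) (by positivity) (by rw [div_le_iff₀ hq0]; nlinarith)
    have e1 : c / s + α * (a - c / s) = c / s * (1 + α * (s * a / c - 1)) := by
      field_simp
    have e2 : Real.log (s * a / c) = Real.log a - Real.log c + Real.log s := by
      rw [Real.log_div (by positivity) hq0.ne', Real.log_mul hs0.ne' hq1.ne']
      ring
    rw [e1, Real.log_mul (by positivity) hp.ne', Real.log_div hq0.ne' hs0.ne']
    rw [e2] at hu
    have := mul_le_mul_of_nonneg_left hu h0.le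
    have e3 : f v * c / a / s = f v * (s * a / c)⁻¹ := by field_simp
    rw [e3]
    linarith
  have h1 := Finset.sum_le_sum fun v (_ : v ∈ Finset.univ) => key v
  rw [Finset.sum_add_distrib, ← Finset.mul_sum, ← Finset.mul_sum, Finset.sum_sub_distrib,
    ← Finset.sum_div] at h1
  have h2 := sum_mul_prefixMass_div_le k hf
  rw [← hsdef, ← div_le_iff₀' (by linarith)] at h2
  have h3 := mul_nonneg (show 0 ≤ 1 - α - κ by linarith) (sub_nonneg.2 h2)
  have e4 : slotDeficit k f = ∑ v, f v * (Real.log (prefixMass (k + 1) f v) -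
    Real.log (prefixMass k f v) + Real.log s) := rfl
  rw [e4, smoothGain]
  linarith

theorem smoothing_weight_bounds {r s : ℝ} (hr : 1 ≤ r) (hrs : r ≤ s) :
    0 ≤ (s - r) / (r * (s - 1)) ∧ (s - r) / (r * (s - 1)) ≤ 1 / r := by
  refine ⟨div_nonneg (by linarith) (mul_nonneg (by linarith) (by linarith)), ?_⟩
  rw [mul_comm, ← div_div]
  refine div_le_div_of_nonneg_right ?_ (by linarith)
  exact div_le_one_of_le₀ (by linarith) (by linarith)

theorem smoothGain_nonneg {k : Fin N} {f : Equiv.Perm (Fin N) → ℝ} (hf : ∀ v, 0 ≤ f v) {r : ℕ}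
    (hr1 : 1 ≤ r) (hrs : (r : ℝ) ≤ (N : ℝ) - k) : 0 ≤ smoothGain r k f := by
  have hr1' : (1 : ℝ) ≤ r := by exact_mod_cast hr1
  obtain ⟨h0, h1⟩ := smoothing_weight_bounds hr1' hrs
  have h2 := h1.trans (div_le_one_of_le₀ hr1' (by linarith))
  have h := le_smoothGain (κ := 0) hf hr1 hrs rfl (by linarith) fun u hu hus => by
    refine ⟨?_, ?_⟩
    · rcases h2.eq_or_lt with h3 | h3
      · rw [h3]; linarith
      · nlinarith [mul_nonneg h0 hu.le]
    · have := one_sub_inv_le_log_sub_log h0 h2 hu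
      linarith
  simpa using h

theorem slotDeficit_nonneg (k : Fin N) {f : Equiv.Perm (Fin N) → ℝ} (hf : ∀ v, 0 ≤ f v) :
    0 ≤ slotDeficit k f := by
  have hs := one_le_remaining k
  have h2 := sum_mul_prefixMass_div_le k hf
  rw [← div_le_iff₀' (by linarith)] at h2
  refine (sub_nonneg.2 h2).trans ?_
  rw [Finset.sum_div, ← Finset.sum_sub_distrib]
  refine Finset.sum_le_sum fun v _ => ?_
  rcases (hf v).eq_or_lt with h0 | h0
  · simp [← h0]
  have hq1 : 0 < prefixMass (k + 1) f v := h0.trans_le (le_fibreMass hf v)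
  have hq0 : 0 < prefixMass k f v := h0.trans_le (le_fibreMass hf v)
  have hs0 : 0 < (N : ℝ) - k := by linarith
  have hu := Real.one_sub_inv_le_log_of_pos
    (x := ((N : ℝ) - k) * prefixMass (k + 1) f v / prefixMass k f v) (by positivity)
  rw [Real.log_div (by positivity) hq0.ne', Real.log_mul hs0.ne' hq1.ne'] at hu
  have := mul_le_mul_of_nonneg_left hu h0.le
  have e3 : f v * prefixMass k f v / prefixMass (k + 1) f v / ((N : ℝ) - k) =
    f v * (((N : ℝ) - k) * prefixMass (k + 1) f v / prefixMass k f v)⁻¹ := by field_simp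
  rw [e3]
  linarith

/-- A slot revealed while its block still has many slots, or all remaining ones, gains a fixed
fraction of the entropy deficit. -/
theorem mul_slotDeficit_le_smoothGain {k : Fin N} {f : Equiv.Perm (Fin N) → ℝ}
    (hf : ∀ v, 0 ≤ f v) {r : ℕ} (hr1 : 1 ≤ r) (hrs : (r : ℝ) ≤ (N : ℝ) - k) {κ r₀ : ℝ}
    (hr₀ : 20 ≤ r₀) (hκ0 : 0 ≤ κ) (hκ1 : κ ≤ 1 / 2) (hκ : κ * Real.log N ≤ Real.log r₀ - 3)
    (h : r₀ ≤ r ∨ (r : ℝ) = (N : ℝ) - k) :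
    κ * slotDeficit k f ≤ smoothGain r k f := by
  have hs := one_le_remaining k
  have hr1' : (1 : ℝ) ≤ r := by exact_mod_cast hr1
  obtain ⟨h0, h1⟩ := smoothing_weight_bounds hr1' hrs
  rcases h with h | h
  · have h20 : (20 : ℝ) ≤ r := hr₀.trans h
    have h2 := h1.trans (one_div_le_one_div_of_le (by norm_num) h20)
    refine le_smoothGain hf hr1 hrs rfl (by linarith) fun u hu hus => ⟨?_, ?_⟩
    · nlinarith [mul_nonneg h0 hu.le]
    · refine entropy_gain h20 h0 h1 hκ0 hκ1 ?_ hu hus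
      have h3 : Real.log ((N : ℝ) - k) ≤ Real.log N :=
        Real.log_le_log (by linarith) (by linarith [Nat.cast_nonneg (α := ℝ) (k : ℕ)])
      have h4 : Real.log r₀ ≤ Real.log r := Real.log_le_log (by linarith) h
      have := mul_le_mul_of_nonneg_left h3 hκ0
      linarith
  -- The block is all that remains, so the content becomes exactly uniform.
  · refine le_smoothGain (α := 0) hf hr1 hrs (by rw [h]; simp) (by linarith)
      fun u hu hus => ⟨by simp, ?_⟩
    have := mul_le_mul_of_nonneg_left (Real.one_sub_inv_le_log_of_pos hu)
      (show 0 ≤ 1 - κ by linarith)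
    simp
    linarith

end SlotEntropy

/-! ### Placing blocks of slots inside single-server groups. -/

section BlockLabels

variable {N : ℕ}

/-- Labels that cut the slots from `o` to `o + q * l` into `q` consecutive blocks of length `l`
and make every other slot a block of its own. -/
def blockLabel (o q l : ℕ) (j : Fin N) : ℕ :=
  if o ≤ (j : ℕ) ∧ (j : ℕ) < o + q * l then (j - o) / l else q + j

theorem blockLabel_eq {o q l a : ℕ} {j : Fin N} (ha : a < q) (h1 : o + a * l ≤ j)
    (h2 : (j : ℕ) < o + (a + 1) * l) : blockLabel o q l j = a := by
  have h3 : (a + 1) * l ≤ q * l := Nat.mul_le_mul_right l ha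
  rw [blockLabel, if_pos ⟨by omega, by omega⟩, Nat.div_eq_iff (by
    rcases Nat.eq_zero_or_pos l with rfl | h
    · omega
    · exact h)]
  rw [Nat.add_mul] at h2
  constructor <;> omega

theorem le_card_laterBlock {o q l a : ℕ} {k : Fin N} (hN : o + q * l ≤ N) (ha : a < q)
    (h1 : o + a * l ≤ k) (h2 : (k : ℕ) < o + (a + 1) * l) :
    o + (a + 1) * l - k ≤ (laterBlock k (blockLabel o q l) k).card := by
  have h3 : (a + 1) * l ≤ q * l := Nat.mul_le_mul_right l ha
  have hk := blockLabel_eq ha h1 h2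
  rw [← Nat.card_Ico, ← Finset.card_image_of_injective _ (Fin.val_injective (n := N))]
  refine Finset.card_le_card fun x hx => ?_
  rw [Finset.mem_Ico] at hx
  refine Finset.mem_image.2 ⟨⟨x, by omega⟩, mem_laterBlock.2 ⟨hx.1, ?_⟩, rfl⟩
  rw [hk]
  exact blockLabel_eq ha (h1.trans hx.1) hx.2

theorem card_laterBlock_le {β : Type*} (k : Fin N) (b : Fin N → β) :
    (laterBlock k b k).card ≤ N - k := by
  rw [← Fin.card_Ici]
  refine Finset.card_le_card fun x hx => ?_
  rw [mem_laterBlock] at hx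
  exact Finset.mem_Ici.2 hx.1

/-- Four placements of the blocks suffice for every slot to be early in its block, or in a block
that contains all later slots. -/
theorem exists_offset_covering {r q : ℕ} (hr : 0 < r) (hq : N ≤ 2 * (q * (2 * r)))
    (hN : q * (2 * r) + r ≤ N) (k : Fin N) :
    ∃ o ∈ ({0, r, N - q * (2 * r), N - q * (2 * r) - r} : Finset ℕ),
      r ≤ (laterBlock k (blockLabel o q (2 * r)) k).card ∨
        (laterBlock k (blockLabel o q (2 * r)) k).card = N - k := by
  have hl : 0 < 2 * r := by omega
  have hk := k.2
  rcases lt_or_ge (k : ℕ) (q * (2 * r)) with h | h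
  · have h1 := Nat.div_add_mod' (k : ℕ) (2 * r)
    have h2 := Nat.mod_lt (k : ℕ) hl
    have h3 : (k : ℕ) / (2 * r) < q := Nat.div_lt_of_lt_mul (by rwa [mul_comm])
    set a := (k : ℕ) / (2 * r)
    set t := (k : ℕ) % (2 * r)
    rcases le_or_gt t r with h4 | h4
    · refine ⟨0, by simp, Or.inl ?_⟩
      have := le_card_laterBlock (o := 0) (k := k) (l := 2 * r) (by omega) h3 (by omega)
        (by rw [Nat.add_mul]; omega)
      refine le_trans ?_ this
      rw [Nat.add_mul]; omega
    · refine ⟨r, by simp, Or.inl ?_⟩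
      have := le_card_laterBlock (o := r) (k := k) (l := 2 * r) (by omega) h3 (by omega)
        (by rw [Nat.add_mul]; omega)
      refine le_trans ?_ this
      rw [Nat.add_mul]; omega
  -- These blocks end at the last slot, and `hq` makes them reach back to slot `k`.
  · obtain ⟨o, ho⟩ : ∃ o, o = N - q * (2 * r) := ⟨_, rfl⟩
    have h1 := Nat.div_add_mod' ((k : ℕ) - o) (2 * r)
    have h2 := Nat.mod_lt ((k : ℕ) - o) hl
    have h3 : ((k : ℕ) - o) / (2 * r) < q :=
      Nat.div_lt_of_lt_mul (by rw [mul_comm]; omega)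
    rw [← ho]
    set a := ((k : ℕ) - o) / (2 * r)
    set t := ((k : ℕ) - o) % (2 * r)
    have h5 := le_card_laterBlock (o := o) (q := q) (k := k) (l := 2 * r) (by omega) h3 (by omega)
        (by rw [Nat.add_mul]; omega)
    rcases le_or_gt t r with h4 | h4
    · refine ⟨o, by simp, Or.inl (le_trans ?_ h5)⟩
      rw [Nat.add_mul]; omega
    -- Shifting back by `r` puts the slot early in the next block. The last block has no successor,
    -- but there the rest of the block is everything that remains.
    · rcases eq_or_ne (a + 1) q with h6 | h6
      · refine ⟨o, by simp, Or.inr (le_antisymm (card_laterBlock_le _ _) (le_trans ?_ h5))⟩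
        rw [h6]; omega
      · refine ⟨o - r, by simp, Or.inl ?_⟩
        have h7 : (a + 1) * (2 * r) = a * (2 * r) + 2 * r := by ring
        have h8 : (a + 1 + 1) * (2 * r) = a * (2 * r) + 2 * r + 2 * r := by ring
        have := le_card_laterBlock (o := o - r) (q := q) (k := k) (a := a + 1) (l := 2 * r) (by omega)
          (by omega) (by omega) (by omega)
        refine le_trans ?_ this
        omega

/-- Among many slots assigned to few servers one finds `q` disjoint groups of `l` slots, each
assigned to a single server. -/
theorem exists_monochromatic_groups {S : Type*} [Fintype S] [Nonempty S] (F : Fin N → S) (l : ℕ) :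
    ∀ q : ℕ, q * l + Fintype.card S * l ≤ N →
      ∃ (e : ℕ → Fin l → Fin N) (g : ℕ → S), (∀ a < q, ∀ c, F (e a c) = g a) ∧
        ∀ a < q, ∀ a' < q, ∀ c c', e a c = e a' c' → a = a' ∧ c = c' := by
  classical
  intro q
  induction q with
  | zero =>
    intro h
    rcases Nat.eq_zero_or_pos l with rfl | hl
    · exact ⟨fun _ c => c.elim0, fun _ => Classical.arbitrary S, by simp, by simp⟩
    · have : 0 < N := by
        have := Nat.mul_pos (Fintype.card_pos (α := S)) hl
        omega
      exact ⟨fun _ _ => ⟨0, this⟩, fun _ => Classical.arbitrary S, by simp, by simp⟩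
  | succ q ih =>
    intro h
    rw [Nat.add_mul] at h
    obtain ⟨e, g, he, hinj⟩ := ih (by omega)
    let U : Finset (Fin N) := (Finset.range q ×ˢ (Finset.univ : Finset (Fin l))).image
      fun p => e p.1 p.2
    have hU : U.card ≤ q * l := by
      refine Finset.card_image_le.trans ?_
      simp
    have hUc : Fintype.card S * l ≤ Uᶜ.card := by
      rw [Finset.card_compl, Fintype.card_fin]
      omega
    -- Greedy choice: at least `card S * l` slots are unused, so some server has `l` of them.
    obtain ⟨y, -, hy⟩ := Finset.exists_le_card_fiber_of_mul_le_card_of_maps_to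
      (s := Uᶜ) (t := (Finset.univ : Finset S)) (f := F) (n := l) (by simp)
      Finset.univ_nonempty (by rwa [Finset.card_univ])
    obtain ⟨V, hV, hVc⟩ := Finset.exists_subset_card_eq hy
    have hmem : ∀ c : Fin l, V.orderEmbOfFin hVc c ∉ U ∧ F (V.orderEmbOfFin hVc c) = y := by
      intro c
      have := hV (V.orderEmbOfFin_mem hVc c)
      simpa using this
    have hUm : ∀ a < q, ∀ c, e a c ∈ U := fun a ha c =>
      Finset.mem_image.2 ⟨(a, c), by simp [ha], rfl⟩
    refine ⟨Function.update e q (V.orderEmbOfFin hVc), Function.update g q y, ?_, ?_⟩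
    · intro a ha c
      rcases eq_or_ne a q with rfl | hne
      · simp [hmem]
      · simp [hne, he a (by omega) c]
    · intro a ha a' ha' c c' hcc
      by_cases hq : a = q <;> by_cases hq' : a' = q
      · subst hq hq'
        simpa using hcc
      · rw [hq, Function.update_self, Function.update_of_ne hq'] at hcc
        exact absurd (hcc ▸ hUm a' (by omega) c') (hmem c).1
      · rw [hq', Function.update_self, Function.update_of_ne hq] at hcc
        exact absurd (hcc ▸ hUm a (by omega) c) (hmem c').1
      · rw [Function.update_of_ne hq, Function.update_of_ne hq'] at hcc
        exact hinj a (by omega) a' (by omega) c c' hcc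

/-- The slots can be reordered so that the blocks at a given offset lie within the groups of slots
assigned to one server. -/
theorem exists_perm_blockLabel_refines {S : Type*} [Fintype S] [Nonempty S] (F : Fin N → S)
    {o q l : ℕ} (hl : 0 < l) (h : q * l + Fintype.card S * l ≤ N) :
    ∃ w : Equiv.Perm (Fin N), ∀ i j : Fin N,
      blockLabel o q l i = blockLabel o q l j → F (w i) = F (w j) := by
  classical
  obtain ⟨e, g, he, hinj⟩ := exists_monochromatic_groups F l q h
  let s : Finset (Fin N) := Finset.univ.filter fun j => o ≤ (j : ℕ) ∧ (j : ℕ) < o + q * l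
  let f : Fin N → Fin N := fun j => e ((j - o) / l) ⟨(j - o) % l, Nat.mod_lt _ hl⟩
  have hdiv : ∀ j : Fin N, o ≤ (j : ℕ) ∧ (j : ℕ) < o + q * l → ((j : ℕ) - o) / l < q :=
    fun j hj => Nat.div_lt_of_lt_mul (by rw [mul_comm]; omega)
  have hf : Set.InjOn f s := by
    intro i hi j hj hij
    simp only [s, Finset.coe_filter, Finset.mem_univ, true_and, Set.mem_ofPred_eq] at hi hj
    obtain ⟨h1, h2⟩ := hinj _ (hdiv i hi) _ (hdiv j hj) _ _ hij
    have h2' : ((i : ℕ) - o) % l = ((j : ℕ) - o) % l := congrArg Fin.val h2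
    have h3 := Nat.div_add_mod ((i : ℕ) - o) l
    have h4 := Nat.div_add_mod ((j : ℕ) - o) l
    rw [h1, h2'] at h3
    apply Fin.ext
    omega
  obtain ⟨w, hw⟩ := Finset.exists_equiv_extend_of_card_eq (t := (Finset.univ : Finset (Fin N)))
    (by simp) (s := s) (f := f) (by simp) hf
  let w' : Equiv.Perm (Fin N) := w.trans (Equiv.subtypeUnivEquiv (by simp))
  have hw' : ∀ i ∈ s, w' i = f i := hw
  refine ⟨w', fun i j hij => ?_⟩
  by_cases hi : o ≤ (i : ℕ) ∧ (i : ℕ) < o + q * l <;>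
    by_cases hj : o ≤ (j : ℕ) ∧ (j : ℕ) < o + q * l
  · rw [blockLabel, blockLabel, if_pos hi, if_pos hj] at hij
    rw [hw' i (by simpa [s] using hi), hw' j (by simpa [s] using hj), he _ (hdiv i hi),
      he _ (hdiv j hj), hij]
  · rw [blockLabel, blockLabel, if_pos hi, if_neg hj] at hij
    have := hdiv i hi
    omega
  · rw [blockLabel, blockLabel, if_neg hi, if_pos hj] at hij
    have := hdiv j hj
    omega
  · rw [blockLabel, blockLabel, if_neg hi, if_neg hj] at hij
    have : i = j := Fin.ext (by omega)
    rw [this]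

end BlockLabels

/-! ### One layer contracts relative entropy. -/

section Contraction

variable {N : ℕ} {β : Type*}

/-- The relative entropy of a mass function on permutations with respect to the uniform one. -/
noncomputable def relEntropy (f : Equiv.Perm (Fin N) → ℝ) : ℝ :=
  negEntropy f + Real.log (N.factorial : ℝ)

theorem sum_log_remaining (N : ℕ) :
    ∑ k : Fin N, Real.log ((N : ℝ) - k) = Real.log (N.factorial : ℝ) := by
  rw [← Finset.prod_range_add_one_eq_factorial, Nat.cast_prod,
    Real.log_prod fun i _ => by positivity, ← Finset.sum_range_reflect,
    ← Fin.sum_univ_eq_sum_range (fun j => Real.log ((N - 1 - j + 1 : ℕ) : ℝ))]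
  refine Finset.sum_congr rfl fun k _ => ?_
  have := k.2
  congr 1
  rw [show N - 1 - (k : ℕ) + 1 = N - k by omega, Nat.cast_sub k.2.le]

/-- Chain rule: the log prefix masses telescope from `log 1` to `log (f v)`. -/
theorem sum_slotDeficit {f : Equiv.Perm (Fin N) → ℝ} (hf1 : ∑ v, f v = 1) :
    ∑ k, slotDeficit k f = relEntropy f := by
  classical
  have h0 : ∀ v, prefixMass 0 f v = 1 := fun v => by
    have : ∀ w : Equiv.Perm (Fin N), slotPrefix 0 w = slotPrefix 0 v := fun w =>
      slotPrefix_eq_iff.2 fun j hj => absurd hj (Nat.not_lt_zero _)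
    simp [prefixMass, fibreMass, this, hf1]
  have hN : ∀ v, prefixMass N f v = f v := fun v => by
    have : ∀ w : Equiv.Perm (Fin N), slotPrefix N w = slotPrefix N v ↔ w = v := fun w =>
      ⟨fun h => Equiv.ext fun j => slotPrefix_eq_iff.1 h j j.2, fun h => h ▸ rfl⟩
    simp [prefixMass, fibreMass, this, Finset.sum_filter]
  simp only [slotDeficit]
  rw [Finset.sum_comm]
  have : ∀ v, ∑ k : Fin N, f v * (Real.log (prefixMass (k + 1) f v) -
      Real.log (prefixMass k f v) + Real.log ((N : ℝ) - k)) =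
      f v * Real.log (f v) + f v * Real.log (N.factorial : ℝ) := fun v => by
    rw [← Finset.mul_sum, Finset.sum_add_distrib, sum_log_remaining,
      Fin.sum_univ_eq_sum_range (fun k => Real.log (prefixMass (k + 1) f v) -
        Real.log (prefixMass k f v)) N,
      Finset.sum_range_sub (fun k => Real.log (prefixMass k f v)), h0, hN]
    simp
    ring
  simp only [this]
  rw [Finset.sum_add_distrib, ← Finset.sum_mul, hf1, one_mul]
  rfl

theorem negEntropy_translate (f : Equiv.Perm (Fin N) → ℝ) (w : Equiv.Perm (Fin N)) :
    negEntropy (fun v => f (v * w)) = negEntropy f :=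
  Fintype.sum_equiv (Equiv.mulRight w) _ _ fun v => by simp

theorem relEntropy_translate (f : Equiv.Perm (Fin N) → ℝ) (w : Equiv.Perm (Fin N)) :
    relEntropy (fun v => f (v * w)) = relEntropy f := by
  rw [relEntropy, negEntropy_translate, relEntropy]

theorem negEntropy_cosetAverage_comp (F : Fin N → β) (w : Equiv.Perm (Fin N))
    (f : Equiv.Perm (Fin N) → ℝ) :
    negEntropy (cosetAverage (blockSubgroup 0 (F ∘ w)) f) =
      negEntropy (cosetAverage (blockSubgroup 0 F) fun v => f (v * w)) := by
  classical
  have h : ∀ y : Equiv.Perm (Fin N),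
      y ∈ blockSubgroup 0 (F ∘ w) ↔ MulAut.conj w y ∈ blockSubgroup 0 F := fun y => by
    simp only [mem_blockSubgroup, Nat.not_lt_zero, false_imp_iff, implies_true, true_and,
      MulAut.conj_apply, Function.comp_apply, Equiv.Perm.mul_apply]
    refine ⟨fun h j => ?_, fun h j => ?_⟩
    · rw [h]; simp
    · simpa using h (w j)
  have e : ∀ v, cosetAverage (blockSubgroup 0 (F ∘ w)) f (v * w) =
      cosetAverage (blockSubgroup 0 F) (fun v => f (v * w)) v := fun v =>
    Fintype.expect_equiv ((MulAut.conj w).toEquiv.subtypeEquiv h) _ _ fun y => by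
      simp [mul_assoc]
  rw [← negEntropy_translate _ w]
  simp only [e]

/-- The entropy lost by shuffling the blocks of a label, averaged over the order of the slots. -/
theorem le_negEntropy_sub_expect (b : Fin N → β) {f : Equiv.Perm (Fin N) → ℝ}
    (hf : ∀ v, 0 ≤ f v) {κ : ℝ} {r : ℕ} (hr : 20 ≤ r) (hκ0 : 0 ≤ κ) (hκ1 : κ ≤ 1 / 2)
    (hκ : κ * Real.log N ≤ Real.log r - 3) (s : Finset (Fin N))
    (hs : ∀ k ∈ s, r ≤ (laterBlock k b k).card ∨ (laterBlock k b k).card = N - k) :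
    ∑ k ∈ s, κ * 𝔼 w : Equiv.Perm (Fin N), slotDeficit k (fun v => f (v * w)) ≤
      negEntropy f - 𝔼 w : Equiv.Perm (Fin N),
        negEntropy (cosetAverage (blockSubgroup 0 b) fun v => f (v * w)) := by
  have hcard : ∀ k : Fin N, 1 ≤ (laterBlock k b k).card ∧
      ((laterBlock k b k).card : ℝ) ≤ (N : ℝ) - k := fun k => by
    refine ⟨Finset.card_pos.2 ⟨k, self_mem_laterBlock b le_rfl⟩, ?_⟩
    rw [← Nat.cast_sub k.2.le]
    exact_mod_cast card_laterBlock_le k b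
  calc ∑ k ∈ s, κ * 𝔼 w : Equiv.Perm (Fin N), slotDeficit k (fun v => f (v * w))
      ≤ ∑ k ∈ s, 𝔼 w : Equiv.Perm (Fin N), stageGain k b (fun v => f (v * w)) := by
        refine Finset.sum_le_sum fun k hk => le_trans ?_ (expect_smoothGain_le k b hf)
        rw [Finset.mul_expect]
        refine Finset.expect_le_expect fun w _ => ?_
        refine mul_slotDeficit_le_smoothGain (r₀ := r) (fun v => hf _) (hcard k).1 (hcard k).2
          (by exact_mod_cast hr) hκ0 hκ1 hκ ?_
        rcases hs k hk with h | h
        · exact Or.inl (by exact_mod_cast h)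
        · exact Or.inr (by rw [h, Nat.cast_sub k.2.le])
    _ ≤ ∑ k, 𝔼 w : Equiv.Perm (Fin N), stageGain k b (fun v => f (v * w)) := by
        refine Finset.sum_le_sum_of_subset_of_nonneg (Finset.subset_univ _) fun k _ _ =>
          le_trans (Finset.expect_nonneg fun w _ => ?_) (expect_smoothGain_le k b hf)
        exact smoothGain_nonneg (fun v => hf _) (hcard k).1 (hcard k).2
    _ = 𝔼 w : Equiv.Perm (Fin N), ∑ k, stageGain k b (fun v => f (v * w)) := by
        rw [Finset.expect_sum_comm]
    _ ≤ 𝔼 w : Equiv.Perm (Fin N), (negEntropy f -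
          negEntropy (cosetAverage (blockSubgroup 0 b) fun v => f (v * w))) := by
        refine Finset.expect_le_expect fun w _ => ?_
        rw [← negEntropy_translate f w]
        exact sum_stageGain_le b fun v => hf _
    _ = _ := by
        rw [Finset.expect_sub_distrib, Finset.expect_const Finset.univ_nonempty]

variable {S : Type*} [Fintype S] [Nonempty S]

/-- A uniform assignment is invariant under reordering the slots, so a random order `w` comes for
free. For each `F` a suitable reordering puts the blocks of `b` inside the groups of `F`, and
shuffling larger groups only lowers the negative entropy. -/
theorem expect_negEntropy_le {b : Fin N → β} {f : Equiv.Perm (Fin N) → ℝ} (hf : ∀ v, 0 ≤ f v)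
    (hb : ∀ F : Fin N → S, ∃ w : Equiv.Perm (Fin N), ∀ i j, b i = b j → F (w i) = F (w j)) :
    𝔼 F : Fin N → S, negEntropy (cosetAverage (blockSubgroup 0 F) f) ≤
      𝔼 w : Equiv.Perm (Fin N),
        negEntropy (cosetAverage (blockSubgroup 0 b) fun v => f (v * w)) := by
  classical
  have h1 : ∀ w : Equiv.Perm (Fin N),
      𝔼 F : Fin N → S, negEntropy (cosetAverage (blockSubgroup 0 F) fun v => f (v * w)) =
        𝔼 F : Fin N → S, negEntropy (cosetAverage (blockSubgroup 0 F) f) := fun w =>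
    Fintype.expect_equiv (Equiv.arrowCongr w.symm (Equiv.refl S)) _ _ fun F => by
      rw [← negEntropy_cosetAverage_comp]
      rfl
  rw [← Finset.expect_const (s := (Finset.univ : Finset (Equiv.Perm (Fin N))))
    Finset.univ_nonempty (𝔼 F : Fin N → S, negEntropy (cosetAverage (blockSubgroup 0 F) f)),
    Finset.expect_congr rfl fun w _ => (h1 w).symm, Finset.expect_comm]
  refine Finset.expect_le (s := (Finset.univ : Finset (Fin N → S))) Finset.univ_nonempty
    fun F _ => ?_
  obtain ⟨u, hu⟩ := hb F
  have h2 : 𝔼 w : Equiv.Perm (Fin N),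
      negEntropy (cosetAverage (blockSubgroup 0 F) fun v => f (v * w)) =
      𝔼 w : Equiv.Perm (Fin N),
        negEntropy (cosetAverage (blockSubgroup 0 (F ∘ u)) fun v => f (v * w)) :=
    (Fintype.expect_equiv (Equiv.mulLeft u) _ _ fun w => by
      rw [negEntropy_cosetAverage_comp]
      simp [mul_assoc]).symm
  rw [h2]
  refine Finset.expect_le_expect fun w _ => negEntropy_cosetAverage_anti ?_ fun v => hf _
  exact fun y hy => ⟨fun j hj => absurd hj (Nat.not_lt_zero _), fun j => hu _ _ (hy.2 j)⟩

/-- Shuffling within the groups of slots assigned to the same server, for a uniformly random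
assignment, contracts the relative entropy. -/
theorem expect_relEntropy_cosetAverage_le {f : Equiv.Perm (Fin N) → ℝ} (hf : ∀ v, 0 ≤ f v)
    (hf1 : ∑ v, f v = 1) {κ : ℝ} {r : ℕ} (hr : 20 ≤ r) (hκ0 : 0 ≤ κ) (hκ1 : κ ≤ 1 / 2)
    (hκ : κ * Real.log N ≤ Real.log r - 3) (hN : 4 * r * (Fintype.card S + 1) ≤ N) :
    𝔼 F : Fin N → S, relEntropy (cosetAverage (blockSubgroup 0 F) f) ≤
      (1 - κ / 4) * relEntropy f := by
  classical
  -- The blocks must fill half of the slots for the covering, yet leave `2 * r` slots per server for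
  -- the pigeonhole argument.
  obtain ⟨q, hq1, hq2⟩ : ∃ q, N ≤ 2 * (q * (2 * r)) ∧ 2 * (q * (2 * r)) ≤ N + 4 * r := by
    refine ⟨N / (4 * r) + 1, ?_, ?_⟩
    · have := Nat.div_add_mod N (4 * r)
      have := Nat.mod_lt N (show 0 < 4 * r by omega)
      have e : 2 * ((N / (4 * r) + 1) * (2 * r)) = 4 * r * (N / (4 * r)) + 4 * r := by ring
      omega
    · have := Nat.div_add_mod N (4 * r)
      have e : 2 * ((N / (4 * r) + 1) * (2 * r)) = 4 * r * (N / (4 * r)) + 4 * r := by ring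
      omega
  have hc := Fintype.card_pos (α := S)
  have hcr : r ≤ Fintype.card S * r := Nat.le_mul_of_pos_left r hc
  have e1 : 4 * r * (Fintype.card S + 1) = 4 * (Fintype.card S * r) + 4 * r := by ring
  have e2 : Fintype.card S * (2 * r) = 2 * (Fintype.card S * r) := by ring
  set O : Finset ℕ := {0, r, N - q * (2 * r), N - q * (2 * r) - r} with hO
  set E := 𝔼 F : Fin N → S, negEntropy (cosetAverage (blockSubgroup 0 F) f) with hE
  have hcov := exists_offset_covering (N := N) (r := r) (q := q) (by omega) hq1 (by omega)
  let s : ℕ → Finset (Fin N) := fun o => Finset.univ.filter fun k =>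
    r ≤ (laterBlock k (blockLabel o q (2 * r)) k).card ∨
      (laterBlock k (blockLabel o q (2 * r)) k).card = N - k
  have h1 : ∀ o, ∑ k ∈ s o, κ * 𝔼 w : Equiv.Perm (Fin N), slotDeficit k (fun v => f (v * w)) ≤
      negEntropy f - E := fun o => by
    have h2 := le_negEntropy_sub_expect (blockLabel o q (2 * r)) hf hr hκ0 hκ1 hκ (s o)
      fun k hk => (Finset.mem_filter.1 hk).2
    have h3 := expect_negEntropy_le (S := S) (b := blockLabel o q (2 * r)) hf fun F =>
      exists_perm_blockLabel_refines F (by omega) (by omega)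
    linarith
  have hnn : ∀ k : Fin N, 0 ≤ κ * 𝔼 w : Equiv.Perm (Fin N), slotDeficit k (fun v => f (v * w)) :=
    fun k => mul_nonneg hκ0 (Finset.expect_nonneg fun w _ => slotDeficit_nonneg k fun v => hf _)
  have h4 : ∑ k : Fin N, κ * 𝔼 w : Equiv.Perm (Fin N), slotDeficit k (fun v => f (v * w)) =
      κ * relEntropy f := by
    rw [← Finset.mul_sum, ← Finset.expect_sum_comm]
    congr 1
    rw [Finset.expect_congr rfl fun w _ => sum_slotDeficit (f := fun v => f (v * w)) ?_]
    · simp only [relEntropy_translate]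
      exact Finset.expect_const Finset.univ_nonempty _
    · rw [← hf1]
      exact Fintype.sum_equiv (Equiv.mulRight w) _ _ fun v => by simp
  -- Every slot is good for at least one of the four offsets, so together the four bounds account
  -- for all deficits.
  have h5 : κ * relEntropy f ≤ ∑ o ∈ O, (negEntropy f - E) := by
    rw [← h4]
    refine le_trans ?_ (Finset.sum_le_sum fun o _ => h1 o)
    simp only [s, Finset.sum_filter]
    rw [Finset.sum_comm]
    refine Finset.sum_le_sum fun k _ => ?_
    obtain ⟨o, ho, h⟩ := hcov k
    refine le_trans (by rw [if_pos h]) (Finset.single_le_sum (f := fun o => if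
      r ≤ (laterBlock k (blockLabel o q (2 * r)) k).card ∨
        (laterBlock k (blockLabel o q (2 * r)) k).card = N - k then
      κ * 𝔼 w : Equiv.Perm (Fin N), slotDeficit k (fun v => f (v * w)) else 0)
      (fun o _ => ?_) ho)
    split_ifs
    exacts [hnn k, le_rfl]
  have hcard : (O.card : ℝ) ≤ 4 := by exact_mod_cast Finset.card_le_four
  have h6 : 0 ≤ negEntropy f - E := (Finset.sum_nonneg fun k _ => hnn k).trans (h1 0)
  rw [Finset.sum_const, nsmul_eq_mul] at h5
  have h7 := mul_le_mul_of_nonneg_right hcard h6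
  have h8 : 𝔼 F : Fin N → S, relEntropy (cosetAverage (blockSubgroup 0 F) f) =
      E + Real.log (N.factorial : ℝ) := by
    simp only [relEntropy]
    rw [Finset.expect_add_distrib, Finset.expect_const Finset.univ_nonempty]
  rw [h8]
  have : relEntropy f = negEntropy f + Real.log (N.factorial : ℝ) := rfl
  linarith

end Contraction

/-! ### Many layers, and from entropy to total variation. -/

section Iteration

theorem expect_fin_succ {X : Type*} [Fintype X] {t : ℕ} (φ : (Fin (t + 1) → X) → ℝ) :
    𝔼 F, φ F = 𝔼 x, 𝔼 F : Fin t → X, φ (Fin.cons x F) := by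
  rw [← Finset.expect_product' Finset.univ Finset.univ fun x F => φ (Fin.cons x F),
    Finset.univ_product_univ]
  exact (Fintype.expect_equiv (Fin.consEquiv fun _ => X) _ _ fun _ => rfl).symm

variable {N : ℕ} {S : Type*}

/-- The mass function after shuffling successively within the groups of a sequence of server
assignments. -/
noncomputable def mixedMass : (t : ℕ) → (Fin t → Fin N → S) → (Equiv.Perm (Fin N) → ℝ) →
    Equiv.Perm (Fin N) → ℝ
  | 0, _, f => f
  | t + 1, F, f => mixedMass t (fun i => F i.succ) (cosetAverage (blockSubgroup 0 (F 0)) f)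

theorem mixedMass_nonneg : ∀ (t : ℕ) (F : Fin t → Fin N → S) {f : Equiv.Perm (Fin N) → ℝ},
    (∀ v, 0 ≤ f v) → ∀ v, 0 ≤ mixedMass t F f v
  | 0, _, _, hf => hf
  | t + 1, _, _, hf => mixedMass_nonneg t _ (cosetAverage_nonneg _ hf)

theorem sum_mixedMass : ∀ (t : ℕ) (F : Fin t → Fin N → S) (f : Equiv.Perm (Fin N) → ℝ),
    ∑ v, mixedMass t F f v = ∑ v, f v
  | 0, _, _ => rfl
  | t + 1, _, _ => (sum_mixedMass t _ _).trans (sum_cosetAverage _ _)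

theorem mixedMass_cons (t : ℕ) (x : Fin N → S) (F : Fin (t + 1) → Fin N → S)
    (f : Equiv.Perm (Fin N) → ℝ) :
    mixedMass (t + 1) (fun i => (Fin.cons x F : Fin (t + 2) → Fin N → S) i.castSucc) f =
      mixedMass t (fun i => F i.castSucc) (cosetAverage (blockSubgroup 0 x) f) := by
  rw [mixedMass]
  rfl

/-- The layers are independent, so contraction applies to whatever the first shuffle produced. The
last of the `t + 1` layers shuffles nothing. -/
theorem expect_relEntropy_mixedMass_le [Fintype S] [Nonempty S] {κ : ℝ} {r : ℕ} (hr : 20 ≤ r)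
    (hκ0 : 0 ≤ κ) (hκ1 : κ ≤ 1 / 2) (hκ : κ * Real.log N ≤ Real.log r - 3)
    (hN : 4 * r * (Fintype.card S + 1) ≤ N) (t : ℕ) {f : Equiv.Perm (Fin N) → ℝ}
    (hf : ∀ v, 0 ≤ f v) (hf1 : ∑ v, f v = 1) :
    𝔼 F : Fin (t + 1) → Fin N → S, relEntropy (mixedMass t (fun i => F i.castSucc) f) ≤
      (1 - κ / 4) ^ t * relEntropy f := by
  classical
  induction t generalizing f with
  | zero => simp [mixedMass, Finset.expect_const Finset.univ_nonempty]
  | succ t ih =>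
    rw [expect_fin_succ]
    simp only [mixedMass_cons]
    calc _ ≤ 𝔼 x : Fin N → S, (1 - κ / 4) ^ t * relEntropy (cosetAverage (blockSubgroup 0 x) f) :=
          Finset.expect_le_expect fun x _ => ih (cosetAverage_nonneg _ hf)
            ((sum_cosetAverage _ _).trans hf1)
      _ = (1 - κ / 4) ^ t * 𝔼 x : Fin N → S, relEntropy (cosetAverage (blockSubgroup 0 x) f) := by
          rw [Finset.mul_expect]
      _ ≤ (1 - κ / 4) ^ t * ((1 - κ / 4) * relEntropy f) :=
          mul_le_mul_of_nonneg_left (expect_relEntropy_cosetAverage_le hf hf1 hr hκ0 hκ1 hκ hN)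
            (pow_nonneg (by linarith) _)
      _ = _ := by ring

/-- A Pinsker-type bound through Hellinger distance: factor `x - 1 = (√x - 1) * (√x + 1)` at `x = N!
* f v` and apply Cauchy–Schwarz. -/
theorem sqrt_relEntropy_bound {f : Equiv.Perm (Fin N) → ℝ} (hf : ∀ v, 0 ≤ f v)
    (hf1 : ∑ v, f v = 1) :
    0 ≤ relEntropy f ∧
      ∑ v, |f v - (N.factorial : ℝ)⁻¹| ≤ 2 * Real.sqrt (relEntropy f) := by
  set M : ℝ := (N.factorial : ℝ) with hM
  have hM0 : 0 < M := by positivity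
  have hcard : ∑ _v : Equiv.Perm (Fin N), (1 : ℝ) = M := by
    simp [Fintype.card_perm, hM]
  have h1 : ∀ v, (Real.sqrt (M * f v) - 1) ^ 2 ≤
      M * (f v * Real.log (f v)) + M * Real.log M * f v - M * f v + 1 := fun v => by
    rcases (hf v).eq_or_lt with h | h
    · simp [← h]
    · refine (sq_sub_one_le_entropy (mul_pos hM0 h)).trans_eq ?_
      rw [Real.log_mul hM0.ne' h.ne']
      ring
  have h2 : ∑ v, (Real.sqrt (M * f v) - 1) ^ 2 ≤ M * relEntropy f := by
    refine (Finset.sum_le_sum fun v _ => h1 v).trans_eq ?_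
    rw [Finset.sum_add_distrib, Finset.sum_sub_distrib, Finset.sum_add_distrib, ← Finset.mul_sum,
      ← Finset.mul_sum, ← Finset.mul_sum, hf1, hcard, relEntropy, negEntropy]
    ring
  have h3 : ∑ v, (Real.sqrt (M * f v) + 1) ^ 2 ≤ 4 * M := by
    calc _ ≤ ∑ v, (2 * M * f v + 2 * 1) := Finset.sum_le_sum fun v _ => by
          have := Real.sq_sqrt (mul_nonneg hM0.le (hf v))
          nlinarith [sq_nonneg (Real.sqrt (M * f v) - 1)]
      _ = 4 * M := by
          rw [Finset.sum_add_distrib, ← Finset.mul_sum, ← Finset.mul_sum, hf1, hcard]; ring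
  have hD : 0 ≤ relEntropy f :=
    nonneg_of_mul_nonneg_right ((Finset.sum_nonneg fun v _ => sq_nonneg _).trans h2) hM0
  refine ⟨hD, ?_⟩
  have h4 := Finset.sum_mul_sq_le_sq_mul_sq Finset.univ (fun v => |Real.sqrt (M * f v) - 1|)
    fun v => Real.sqrt (M * f v) + 1
  simp only [sq_abs] at h4
  have h5 : ∀ v, |Real.sqrt (M * f v) - 1| * (Real.sqrt (M * f v) + 1) = M * |f v - M⁻¹| :=
    fun v => by
      have h0 : 0 ≤ Real.sqrt (M * f v) + 1 := by positivity
      rw [← abs_of_nonneg h0, ← abs_mul, ← abs_of_pos hM0, ← abs_mul, abs_of_pos hM0]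
      congr 1
      have := Real.sq_sqrt (mul_nonneg hM0.le (hf v))
      field_simp
      nlinarith
  simp only [h5] at h4
  rw [← Finset.mul_sum] at h4
  have h6 : (M * ∑ v, |f v - M⁻¹|) ^ 2 ≤ (M * (2 * Real.sqrt (relEntropy f))) ^ 2 := by
    refine h4.trans ((mul_le_mul h2 h3 (Finset.sum_nonneg fun v _ => sq_nonneg _)
      (mul_nonneg hM0.le hD)).trans_eq ?_)
    rw [mul_pow, mul_pow, Real.sq_sqrt hD]
    ring
  have h7 := (pow_le_pow_iff_left₀ (mul_nonneg hM0.le (Finset.sum_nonneg fun v _ => abs_nonneg _))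
    (by positivity) two_ne_zero).1 h6
  exact le_of_mul_le_mul_left h7 hM0

theorem expect_sqrt_le_sqrt_expect {ι : Type*} [Fintype ι] [Nonempty ι] {x : ι → ℝ}
    (hx : ∀ i, 0 ≤ x i) : 𝔼 i, Real.sqrt (x i) ≤ Real.sqrt (𝔼 i, x i) := by
  refine Real.le_sqrt_of_sq_le ?_
  have h := sq_sum_le_card_mul_sum_sq (s := Finset.univ) (f := fun i => Real.sqrt (x i))
  simp only [Real.sq_sqrt (hx _)] at h
  have hc : (0 : ℝ) < Fintype.card ι := by exact_mod_cast Fintype.card_pos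
  rw [Fintype.expect_eq_sum_div_card, Fintype.expect_eq_sum_div_card, div_pow,
    div_le_div_iff₀ (by positivity) hc]
  rw [Finset.card_univ] at h
  nlinarith

end Iteration

/-! ### From random server choices to random shuffles. -/

section Transitions

variable {N : ℕ} {S γ : Type*}

/-- The sequence of the transition data of consecutive terms. -/
def transitions {X γ : Type*} (c : X → X → γ) {t : ℕ} (T : Fin (t + 1) → X) : Fin t → γ :=
  fun i => c (T i.castSucc) (T i.succ)

theorem transitions_cons_cons {X γ : Type*} (c : X → X → γ) {t : ℕ} (x y : X) (T : Fin t → X) :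
    transitions c (Fin.cons x (Fin.cons y T) : Fin (t + 2) → X) =
      Fin.cons (c x y) (transitions c (Fin.cons y T : Fin (t + 1) → X)) := by
  funext i
  refine Fin.cases ?_ (fun j => ?_) i <;> rfl

theorem cons_cons_last {X : Type*} {t : ℕ} (x y : X) (T : Fin t → X) :
    (Fin.cons x (Fin.cons y T) : Fin (t + 2) → X) (Fin.last (t + 1)) =
      (Fin.cons y T : Fin (t + 1) → X) (Fin.last t) :=
  rfl

/-- Sampling the layers of server choices is the same as sampling layers of assignments of slots
and shuffling within the groups of slots that are assigned to the same server. -/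
theorem sum_mul_expect_layers [Fintype S] [Nonempty S] {c : (Fin N → S) → (Fin N → S) → γ}
    (hc : ∀ F G, ∀ w : Equiv.Perm (Fin N), c (F ∘ w) (G ∘ w) = c F G) (t : ℕ)
    (f : Equiv.Perm (Fin N) → ℝ) (x : Fin N → S) (ψ : (Fin t → γ) → (Fin N → S) → ℝ) :
    ∑ v : Equiv.Perm (Fin N), f v * 𝔼 T : Fin t → Fin N → S,
        ψ (transitions c (Fin.cons (x ∘ ⇑v⁻¹) T : Fin (t + 1) → Fin N → S))
          ((Fin.cons (x ∘ ⇑v⁻¹) T : Fin (t + 1) → Fin N → S) (Fin.last t)) =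
      𝔼 F : Fin t → Fin N → S, ∑ v : Equiv.Perm (Fin N),
        mixedMass t (fun i => (Fin.cons x F : Fin (t + 1) → Fin N → S) i.castSucc) f v *
          ψ (transitions c (Fin.cons x F : Fin (t + 1) → Fin N → S))
            ((Fin.cons x F : Fin (t + 1) → Fin N → S) (Fin.last t) ∘ ⇑v⁻¹) := by
  classical
  induction t generalizing f x with
  | zero =>
    rw [Finset.expect_eq_sum_div_card]
    simp only [Finset.univ_unique, Finset.sum_singleton, Finset.card_singleton, Nat.cast_one,
      div_one, Finset.expect_singleton]
    exact Finset.sum_congr rfl fun v _ => congrArg (f v * ·)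
      (congrArg₂ ψ (Subsingleton.elim _ _) rfl)
  | succ t ih =>
    let Φ : (Fin N → S) → Equiv.Perm (Fin N) → ℝ := fun y v => 𝔼 T : Fin t → Fin N → S,
      ψ (Fin.cons (c x y) (transitions c (Fin.cons (y ∘ ⇑v⁻¹) T : Fin (t + 1) → Fin N → S)))
        ((Fin.cons (y ∘ ⇑v⁻¹) T : Fin (t + 1) → Fin N → S) (Fin.last t))
    have hsub : ∀ (w : Equiv.Perm (Fin N)) (φ : (Fin N → S) → ℝ),
        𝔼 y : Fin N → S, φ (y ∘ ⇑w) = 𝔼 y : Fin N → S, φ y := fun w φ =>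
      Fintype.expect_equiv (Equiv.arrowCongr w.symm (Equiv.refl S)) _ _ fun y => rfl
    -- Writing the next layer as `y ∘ v⁻¹` keeps `y` uniform and makes the transition independent of
    -- `v`.
    have h1 : ∀ v : Equiv.Perm (Fin N), 𝔼 T : Fin (t + 1) → Fin N → S,
        ψ (transitions c (Fin.cons (x ∘ ⇑v⁻¹) T : Fin (t + 2) → Fin N → S))
          ((Fin.cons (x ∘ ⇑v⁻¹) T : Fin (t + 2) → Fin N → S) (Fin.last (t + 1))) =
        𝔼 y, Φ y v := fun v => by
      rw [expect_fin_succ]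
      simp only [transitions_cons_cons, cons_cons_last]
      rw [← hsub v⁻¹]
      simp only [hc, Φ]
    -- Relabelling `y` by a permutation that preserves `x` does not change the transition. So only
    -- the coset of `v` matters and `f` may be replaced by its average.
    have h2 : ∀ v : Equiv.Perm (Fin N), ∀ w ∈ blockSubgroup 0 x,
        𝔼 y, Φ y (v * w) = 𝔼 y, Φ y v := fun v w hw => by
      rw [← hsub w⁻¹ fun y => Φ y v]
      refine Finset.expect_congr rfl fun y _ => ?_
      have hx : x ∘ ⇑w⁻¹ = x := funext fun j => (inv_mem hw).2 j
      have hcy : c x (y ∘ ⇑w⁻¹) = c x y := by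
        conv_lhs => rw [← hx]
        exact hc x y w⁻¹
      simp only [Φ, hcy, mul_inv_rev, Equiv.Perm.coe_mul, Function.comp_assoc]
    simp only [h1]
    rw [← sum_cosetAverage_mul (blockSubgroup 0 x) f _ h2, expect_fin_succ]
    simp only [Finset.mul_expect]
    rw [← Finset.expect_sum_comm]
    refine Finset.expect_congr rfl fun y _ => ?_
    simp only [transitions_cons_cons, cons_cons_last, mixedMass_cons]
    exact ih _ y fun z => ψ (Fin.cons (c x y) z)

theorem expect_layers [Fintype S] [Nonempty S] {c : (Fin N → S) → (Fin N → S) → γ}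
    (hc : ∀ F G, ∀ w : Equiv.Perm (Fin N), c (F ∘ w) (G ∘ w) = c F G) (t : ℕ)
    (ψ : (Fin N → S) → (Fin t → γ) → (Fin N → S) → ℝ) :
    𝔼 T : Fin (t + 1) → Fin N → S, ψ (T 0) (transitions c T) (T (Fin.last t)) =
      𝔼 F : Fin (t + 1) → Fin N → S, ∑ v : Equiv.Perm (Fin N),
        mixedMass t (fun i => F i.castSucc) (Pi.single 1 1) v *
          ψ (F 0) (transitions c F) (F (Fin.last t) ∘ ⇑v⁻¹) := by
  classical
  rw [expect_fin_succ, expect_fin_succ]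
  refine Finset.expect_congr rfl fun x _ => ?_
  have := sum_mul_expect_layers hc t (Pi.single 1 1) x (ψ x)
  simp only [Fin.cons_zero]
  rw [← this, Finset.sum_eq_single 1]
  · simp
  · intro v _ hv
    simp [hv]
  · simp

/-- The first layer, the transitions and the last layer, relabelled by the recipients, hardly
depend on the recipients. -/
theorem abs_expect_layers_sub_le [Fintype S] [Nonempty S] {c : (Fin N → S) → (Fin N → S) → γ}
    (hc : ∀ F G, ∀ w : Equiv.Perm (Fin N), c (F ∘ w) (G ∘ w) = c F G) {κ : ℝ} {r : ℕ}
    (hr : 20 ≤ r) (hκ0 : 0 ≤ κ) (hκ1 : κ ≤ 1 / 2) (hκ : κ * Real.log N ≤ Real.log r - 3)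
    (hN : 4 * r * (Fintype.card S + 1) ≤ N) (t : ℕ)
    {ψ : (Fin N → S) → (Fin t → γ) → (Fin N → S) → ℝ} (hψ : ∀ x z y, |ψ x z y| ≤ 1)
    (p₀ p₁ : Equiv.Perm (Fin N)) :
    |𝔼 T : Fin (t + 1) → Fin N → S, ψ (T 0) (transitions c T) (T (Fin.last t) ∘ ⇑p₀⁻¹) -
      𝔼 T : Fin (t + 1) → Fin N → S, ψ (T 0) (transitions c T) (T (Fin.last t) ∘ ⇑p₁⁻¹)| ≤
      4 * Real.sqrt ((1 - κ / 4) ^ t * Real.log (N.factorial : ℝ)) := by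
  classical
  set δ : Equiv.Perm (Fin N) → ℝ := Pi.single 1 1 with hδ
  have hδ0 : ∀ v, 0 ≤ δ v := fun v => by
    rcases eq_or_ne v 1 with rfl | h
    · simp [hδ]
    · simp [hδ, h]
  have hδ1 : ∑ v, δ v = 1 := by simp [hδ]
  have hδe : relEntropy δ = Real.log (N.factorial : ℝ) := by
    have : ∀ v, δ v * Real.log (δ v) = 0 := fun v => by
      rcases eq_or_ne v 1 with rfl | h
      · simp [hδ]
      · simp [hδ, h]
    simp [relEntropy, negEntropy, this]
  let m : (Fin (t + 1) → Fin N → S) → Equiv.Perm (Fin N) → ℝ :=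
    fun F => mixedMass t (fun i => F i.castSucc) δ
  have hm0 : ∀ F v, 0 ≤ m F v := fun F => mixedMass_nonneg t _ hδ0
  have hm1 : ∀ F, ∑ v, m F v = 1 := fun F => (sum_mixedMass t _ δ).trans hδ1
  have hD := expect_relEntropy_mixedMass_le (S := S) hr hκ0 hκ1 hκ hN t hδ0 hδ1
  rw [hδe] at hD
  -- The value for a perfectly uniform arrangement; translation by `p` shows that the recipients do
  -- not affect it.
  let U : ℝ := 𝔼 F : Fin (t + 1) → Fin N → S, ∑ v : Equiv.Perm (Fin N),
    (N.factorial : ℝ)⁻¹ * ψ (F 0) (transitions c F) (F (Fin.last t) ∘ ⇑v⁻¹)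
  have key : ∀ p : Equiv.Perm (Fin N),
      |𝔼 T : Fin (t + 1) → Fin N → S, ψ (T 0) (transitions c T) (T (Fin.last t) ∘ ⇑p⁻¹) - U| ≤
        2 * Real.sqrt ((1 - κ / 4) ^ t * Real.log (N.factorial : ℝ)) := fun p => by
    have hU : U = 𝔼 F : Fin (t + 1) → Fin N → S, ∑ v : Equiv.Perm (Fin N),
        (N.factorial : ℝ)⁻¹ * ψ (F 0) (transitions c F) (F (Fin.last t) ∘ ⇑v⁻¹ ∘ ⇑p⁻¹) := by
      refine Finset.expect_congr rfl fun F _ =>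
        (Fintype.sum_equiv (Equiv.mulLeft p) _ _ fun v => ?_).symm
      simp [mul_inv_rev, Equiv.Perm.coe_mul]
    rw [expect_layers hc t fun x z y => ψ x z (y ∘ ⇑p⁻¹), hU, ← Finset.expect_sub_distrib]
    calc _ ≤ 𝔼 F : Fin (t + 1) → Fin N → S, 2 * Real.sqrt (relEntropy (m F)) := by
          refine (Finset.abs_expect_le _ _).trans (Finset.expect_le_expect fun F _ => ?_)
          refine le_trans ?_ (sqrt_relEntropy_bound (hm0 F) (hm1 F)).2
          rw [← Finset.sum_sub_distrib]
          refine (Finset.abs_sum_le_sum_abs _ _).trans (Finset.sum_le_sum fun v _ => ?_)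
          rw [Function.comp_assoc, ← sub_mul, abs_mul]
          exact mul_le_of_le_one_right (abs_nonneg _) (hψ _ _ _)
      _ = 2 * 𝔼 F : Fin (t + 1) → Fin N → S, Real.sqrt (relEntropy (m F)) := by
          rw [Finset.mul_expect]
      _ ≤ 2 * Real.sqrt (𝔼 F : Fin (t + 1) → Fin N → S, relEntropy (m F)) := by
          have := expect_sqrt_le_sqrt_expect fun F =>
            (sqrt_relEntropy_bound (hm0 F) (hm1 F)).1
          linarith
      _ ≤ _ := by
          have := Real.sqrt_le_sqrt hD
          linarith
  have h0 := abs_le.1 (key p₀)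
  have h1 := abs_le.1 (key p₁)
  rw [abs_le]
  constructor <;> linarith

end Transitions

/-! ### Traffic volumes of the protocol. -/

section Traffic

variable {N L : ℕ} {M : Type*}

/-- The party that holds the onion of user `i` at the beginning of round `r`. -/
def onionHolder (σ : SimpleInput N M) (T : Fin N → Fin L → Fin N) (i : Fin N) (r : ℕ) : Fin N :=
  (i :: (List.ofFn (T i) ++ [σ.recipient i])).getD r i

theorem forward_formOnion {P M : Type*} (a : P) (m : M) (p : P) (path : List P) :
    forward a (formOnion m (p :: path)) = some ⟨a, p, formOnion m path⟩ :=
  rfl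

/-- Up to round index `L` every onion still has a layer to peel, so `filterMap` drops none. -/
theorem iterate_nextRound (σ : SimpleInput N M) (T : Fin N → Fin L → Fin N) {r : ℕ}
    (hr : r ≤ L) :
    nextRound^[r] (firstRound σ T) = (Finset.univ : Finset (Fin N)).val.map fun i =>
      ⟨onionHolder σ T i r, onionHolder σ T i (r + 1),
        formOnion (σ.msg i) ((List.ofFn (T i) ++ [σ.recipient i]).drop (r + 1))⟩ := by
  have hlen : ∀ i, (List.ofFn (T i) ++ [σ.recipient i]).length = L + 1 := fun i => by simp
  have hstep : ∀ i, ∀ r ≤ L, ∀ a, forward a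
      (formOnion (σ.msg i) ((List.ofFn (T i) ++ [σ.recipient i]).drop r)) =
      some ⟨a, onionHolder σ T i (r + 1),
        formOnion (σ.msg i) ((List.ofFn (T i) ++ [σ.recipient i]).drop (r + 1))⟩ := by
    intro i r hr a
    rw [List.drop_eq_getElem_cons (by rw [hlen]; omega), forward_formOnion]
    congr 2
    rw [onionHolder, List.getD_cons_succ, List.getD_eq_getElem _ _ (by rw [hlen]; omega)]
  induction r with
  | zero =>
    rw [Function.iterate_zero_apply, firstRound, ← Multiset.filterMap_eq_map]
    congr 1
    funext i
    exact hstep i 0 (Nat.zero_le _) i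
  | succ r ih =>
    rw [Function.iterate_succ_apply', ih (by omega), nextRound, ← Multiset.filterMap_eq_map,
      ← Multiset.filterMap_eq_map, Multiset.filterMap_filterMap]
    congr 1
    funext i
    exact hstep i (r + 1) hr _

theorem trafficOf_onionExecution (σ : SimpleInput N M) (T : Fin N → Fin L → Fin N)
    (r : Fin (L + 1)) (a b : Fin N) :
    trafficOf (onionExecution σ T) r a b =
      (Finset.univ.filter fun i => onionHolder σ T i r = a ∧ onionHolder σ T i (r + 1) = b).card := by
  rw [trafficOf, onionExecution, iterate_nextRound σ T (Nat.lt_succ_iff.1 r.2),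
    Multiset.countP_map]
  rfl

/-- The number of users with consecutive mix-nodes `a` and `b`. -/
def hopCount {s : Finset (Fin N)} (F G : Fin N → s) (a b : Fin N) : ℕ :=
  (Finset.univ.filter fun i => (F i : Fin N) = a ∧ (G i : Fin N) = b).card

theorem hopCount_comp {s : Finset (Fin N)} (F G : Fin N → s) (w : Equiv.Perm (Fin N)) :
    hopCount (F ∘ w) (G ∘ w) = hopCount F G := by
  funext a b
  exact Finset.card_nbij' w w.symm (by intro i; simp) (by intro i; simp) (by intro i; simp)
    (by intro i; simp)

/-- The traffic volumes as a function of the first mix-nodes of the senders, the hop counts, and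
the last mix-nodes of the recipients. -/
def assembleTraffic {s : Finset (Fin N)} {t : ℕ} (x : Fin N → s) (z : Fin t → Fin N → Fin N → ℕ)
    (y : Fin N → s) : Traffic N (t + 1 + 1) :=
  Fin.cons (fun a b => (Finset.univ.filter fun i => i = a ∧ (x i : Fin N) = b).card)
    (Fin.snoc z fun a b => (Finset.univ.filter fun j => (y j : Fin N) = a ∧ j = b).card)

theorem trafficOf_eq_assembleTraffic {s : Finset (Fin N)} {t : ℕ} (σ : SimpleInput N M)
    (T : Fin (t + 1) → Fin N → s) :
    trafficOf (onionExecution σ fun i j => (T j i : Fin N)) =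
      assembleTraffic (T 0) (transitions hopCount T) (T (Fin.last t) ∘ ⇑σ.recipient⁻¹) := by
  have h0 : ∀ i, onionHolder σ (fun i j => (T j i : Fin N)) i 0 = i := fun i => rfl
  have h1 : ∀ i, ∀ j : Fin (t + 1), onionHolder σ (fun i j => (T j i : Fin N)) i (j + 1) =
      T j i := fun i j => by
    rw [onionHolder, List.getD_cons_succ,
      List.getD_append _ _ _ _ (by rw [List.length_ofFn]; exact j.2),
      List.getD_eq_getElem _ _ (by rw [List.length_ofFn]; exact j.2), List.getElem_ofFn]
  have h2 : ∀ i, onionHolder σ (fun i j => (T j i : Fin N)) i (t + 1 + 1) =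
      σ.recipient i := fun i => by
    rw [onionHolder, List.getD_cons_succ, List.getD_append_right _ _ _ _ (by simp)]
    simp
  funext r a b
  rw [trafficOf_onionExecution]
  refine Fin.cases ?_ (fun r => Fin.lastCases ?_ (fun r => ?_) r) r
  · simp only [Fin.val_zero, h0, assembleTraffic, Fin.cons_zero]
    simp only [h1 _ 0, ← Fin.val_zero (t + 1)]
  · simp only [assembleTraffic, Fin.cons_succ, Fin.snoc_last, Fin.val_succ]
    have h3 : ∀ i, onionHolder σ (fun i j => (T j i : Fin N)) i (t + 1) = T (Fin.last t) i :=
      fun i => h1 i (Fin.last t)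
    simp only [Fin.val_last, h2, h3]
    refine Finset.card_nbij' σ.recipient σ.recipient.symm ?_ ?_ (by intro i; simp)
      (by intro i; simp)
    · intro i; simp
    · intro i; simp
  · simp only [assembleTraffic, Fin.cons_succ, Fin.snoc_castSucc, Fin.val_succ, transitions,
      hopCount]
    simp only [h1]
    have := fun i => h1 i r.succ
    simp only [Fin.val_succ] at this
    simp only [Fin.val_castSucc, this]

/-- The distribution of the traffic volumes of the protocol hardly depends on the input. -/
theorem abs_traffic_real_sub_le {s : Finset (Fin N)} [Nonempty s] {κ : ℝ} {r : ℕ} (hr : 20 ≤ r)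
    (hκ0 : 0 ≤ κ) (hκ1 : κ ≤ 1 / 2) (hκ : κ * Real.log N ≤ Real.log r - 3)
    (hN : 4 * r * (s.card + 1) ≤ N) (hL : 1 ≤ L) (σ₀ σ₁ : SimpleInput N M)
    {A : Set (Traffic N (L + 1))} (hA : MeasurableSet A) :
    |((((PMF.uniformOfFintype (Fin N → Fin L → s)).map fun T =>
        onionExecution σ₀ fun i t => (T i t : Fin N)).map trafficOf).toMeasure.real A) -
      ((((PMF.uniformOfFintype (Fin N → Fin L → s)).map fun T =>
        onionExecution σ₁ fun i t => (T i t : Fin N)).map trafficOf).toMeasure.real A)| ≤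
      4 * Real.sqrt ((1 - κ / 4) ^ (L - 1) * Real.log (N.factorial : ℝ)) := by
  classical
  obtain ⟨t, rfl⟩ : ∃ t, L = t + 1 := ⟨L - 1, by omega⟩
  let ψ : (Fin N → s) → (Fin t → Fin N → Fin N → ℕ) → (Fin N → s) → ℝ := fun x z y =>
    if assembleTraffic x z y ∈ A then 1 else 0
  have key : ∀ σ : SimpleInput N M,
      (((PMF.uniformOfFintype (Fin N → Fin (t + 1) → s)).map fun T =>
        onionExecution σ fun i t => (T i t : Fin N)).map trafficOf).toMeasure.real A =
      𝔼 T : Fin (t + 1) → Fin N → s, ψ (T 0) (transitions hopCount T)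
        (T (Fin.last t) ∘ ⇑σ.recipient⁻¹) := fun σ => by
    -- With the discrete σ-algebra on the choices, the probability is a proportion of choices;
    -- `Equiv.piComm` then exchanges users and layers.
    let _ : MeasurableSpace (Fin N → Fin (t + 1) → s) := ⊤
    rw [PMF.map_comp, Measure.real, PMF.toMeasure_map_apply _ _ _ measurable_from_top hA,
      PMF.toMeasure_uniformOfFintype_apply _ MeasurableSpace.measurableSet_top, ENNReal.toReal_div, ENNReal.toReal_natCast,
      ENNReal.toReal_natCast]
    rw [← Fintype.expect_equiv (Equiv.piComm fun (_ : Fin N) (_ : Fin (t + 1)) => (s : Type _))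
      (fun T => if trafficOf (onionExecution σ fun i j => (T i j : Fin N)) ∈ A then 1 else 0) _
      fun T => by
        dsimp only [ψ]
        rw [← trafficOf_eq_assembleTraffic]
        rfl]
    rw [Fintype.expect_eq_sum_div_card, Finset.sum_boole, Fintype.card_ofFinset]
    rfl
  rw [key, key]
  refine abs_expect_layers_sub_le hopCount_comp hr hκ0 hκ1 hκ (by simpa using hN) t
    (fun x z y => ?_) _ _
  dsimp only [ψ]
  split_ifs <;> simp

/-- Fubini: for each fixed value of the coins the event is an event about the traffic alone. -/
theorem statDist_prod_le {Ω C : Type*} [MeasurableSpace Ω] [MeasurableSpace C] (μ₀ μ₁ : Measure Ω)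
    [IsProbabilityMeasure μ₀] [IsProbabilityMeasure μ₁] (ν : Measure C) [IsProbabilityMeasure ν]
    {ε : ℝ} (h : ∀ A, MeasurableSet A → |μ₀.real A - μ₁.real A| ≤ ε) :
    statDist (μ₀.prod ν) (μ₁.prod ν) ≤ ε := by
  have hε : 0 ≤ ε := (abs_nonneg _).trans (h ∅ MeasurableSet.empty)
  have aux : ∀ (μ μ' : Measure Ω) [IsProbabilityMeasure μ] [IsProbabilityMeasure μ'],
      (∀ A, MeasurableSet A → μ.real A ≤ μ'.real A + ε) → ∀ E, MeasurableSet E →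
      (μ.prod ν).real E ≤ (μ'.prod ν).real E + ε := by
    intro μ μ' _ _ h E hE
    have h1 : (μ.prod ν) E ≤ (μ'.prod ν) E + ENNReal.ofReal ε := by
      rw [Measure.prod_apply_symm hE, Measure.prod_apply_symm hE]
      calc _ ≤ ∫⁻ c, (μ' ((fun x => (x, c)) ⁻¹' E) + ENNReal.ofReal ε) ∂ν := by
            refine lintegral_mono fun c => ?_
            have hm : MeasurableSet ((fun x : Ω => (x, c)) ⁻¹' E) := measurable_prodMk_right hE
            have := ENNReal.ofReal_le_ofReal (h _ hm)
            rwa [ENNReal.ofReal_add measureReal_nonneg hε, ofReal_measureReal,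
              ofReal_measureReal] at this
        _ = _ := by
            rw [lintegral_add_right _ measurable_const, lintegral_const, measure_univ, mul_one]
    have h2 := ENNReal.toReal_mono (by finiteness) h1
    rwa [ENNReal.toReal_add (by finiteness) (by finiteness), ENNReal.toReal_ofReal hε] at h2
  have : Nonempty {E : Set (Ω × C) // MeasurableSet E} := ⟨⟨∅, MeasurableSet.empty⟩⟩
  refine ciSup_le fun E => ?_
  have h1 := aux μ₀ μ₁ (fun A hA => by linarith [(abs_le.1 (h A hA)).2]) E.1 E.2
  have h2 := aux μ₁ μ₀ (fun A hA => by linarith [(abs_le.1 (h A hA)).1]) E.1 E.2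
  rw [abs_le]
  constructor <;> linarith

theorem statDist_nonneg {Ω : Type*} [MeasurableSpace Ω] (μ ν : Measure Ω) : 0 ≤ statDist μ ν :=
  Real.iSup_nonneg fun _ => abs_nonneg _

end Traffic

/-! ### Choice of parameters. -/

section Asymptotics

theorem exists_pow_bound_of_polynomial (p : Polynomial ℕ) :
    ∃ d : ℕ, 0 < d ∧ ∀ᶠ k : ℕ in atTop, p.eval k ≤ k ^ d := by
  refine ⟨p.natDegree + 1, Nat.succ_pos _, ?_⟩
  filter_upwards [eventually_ge_atTop (∑ i ∈ Finset.range (p.natDegree + 1), p.coeff i),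
    eventually_ge_atTop 1] with k hk hk1
  calc p.eval k = ∑ i ∈ Finset.range (p.natDegree + 1), p.coeff i * k ^ i :=
        Polynomial.eval_eq_sum_range k
    _ ≤ ∑ i ∈ Finset.range (p.natDegree + 1), p.coeff i * k ^ p.natDegree :=
        Finset.sum_le_sum fun i hi => Nat.mul_le_mul_left _
          (Nat.pow_le_pow_right hk1 (Nat.lt_succ_iff.1 (Finset.mem_range.1 hi)))
    _ ≤ k * k ^ p.natDegree := by
        rw [← Finset.sum_mul]
        exact Nat.mul_le_mul_right _ hk
    _ = _ := by rw [pow_succ']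

theorem exists_pos_log_sq_le {g : ℕ → ℝ} (hg : ∀ k, 0 ≤ g k)
    (h : (fun k : ℕ => Real.logb 2 (k : ℝ) ^ 2) =O[atTop] g) :
    ∃ C : ℝ, 0 < C ∧ ∀ᶠ k : ℕ in atTop, Real.log k ^ 2 ≤ C * g k := by
  obtain ⟨C, hC, hb⟩ := h.exists_pos
  refine ⟨C, hC, ?_⟩
  filter_upwards [hb.bound] with k hk
  rw [Real.norm_of_nonneg (sq_nonneg _), Real.norm_of_nonneg (hg k), Real.logb, div_pow] at hk
  refine le_trans ?_ hk
  have h1 := Real.log_pos one_lt_two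
  have h2 : Real.log 2 ≤ 1 := by linarith [Real.log_two_lt_d9]
  rw [le_div_iff₀ (by positivity)]
  exact mul_le_of_le_one_right (sq_nonneg _) (pow_le_one₀ h1.le h2)

theorem log_factorial_le_sq (N : ℕ) : Real.log (N.factorial : ℝ) ≤ (N : ℝ) ^ 2 := by
  rcases Nat.eq_zero_or_pos N with rfl | hN
  · simp
  have h1 : Real.log (N.factorial : ℝ) ≤ Real.log ((N : ℝ) ^ N) :=
    Real.log_le_log (by positivity) (by exact_mod_cast Nat.factorial_le_pow N)
  rw [Real.log_pow] at h1
  have h2 : Real.log N ≤ N := (Real.log_le_sub_one_of_pos (by exact_mod_cast hN)).trans (by linarith)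
  calc _ ≤ (N : ℝ) * Real.log N := h1
    _ ≤ N * N := mul_le_mul_of_nonneg_left h2 (by positivity)
    _ = _ := by ring

/-- In the exponent `d + m + 1`, the `d` pays for `√(log N!) ≤ N` and the 1 for the factor 4. -/
theorem mixing_bound_le {N L d m : ℕ} {κ x : ℝ} (hx : 4 ≤ x) (hN : (N : ℝ) ≤ x ^ d) (hL : 1 ≤ L)
    (hκ1 : κ ≤ 1 / 2)
    (hκ : 8 * ((d : ℝ) + m + 1) * Real.log x ≤ κ * ((L : ℝ) - 1)) :
    4 * Real.sqrt ((1 - κ / 4) ^ (L - 1) * Real.log (N.factorial : ℝ)) ≤ (x ^ m)⁻¹ := by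
  have hx0 : 0 < x := by linarith
  have h1 : (1 - κ / 4) ^ (L - 1) ≤ ((x ^ (d + m + 1))⁻¹) ^ 2 := by
    calc (1 - κ / 4) ^ (L - 1) ≤ Real.exp (-(κ / 4)) ^ (L - 1) :=
          pow_le_pow_left₀ (by linarith) (Real.one_sub_le_exp_neg _) _
      _ = Real.exp (-(κ * ((L : ℝ) - 1) / 4)) := by
          rw [← Real.exp_nat_mul, Nat.cast_sub hL]
          congr 1
          push_cast; ring
      _ ≤ Real.exp (Real.log (((x ^ (d + m + 1))⁻¹) ^ 2)) := by
          refine Real.exp_le_exp.2 ?_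
          rw [Real.log_pow, Real.log_inv, Real.log_pow]
          push_cast
          linarith
      _ = _ := Real.exp_log (by positivity)
  have h2 : Real.log (N.factorial : ℝ) ≤ (x ^ d) ^ 2 :=
    (log_factorial_le_sq N).trans (pow_le_pow_left₀ (by positivity) hN 2)
  have h3 : Real.sqrt ((1 - κ / 4) ^ (L - 1) * Real.log (N.factorial : ℝ)) ≤
      (x ^ (d + m + 1))⁻¹ * x ^ d := by
    refine Real.sqrt_le_iff.2 ⟨by positivity, ?_⟩
    rw [mul_pow]
    exact mul_le_mul h1 h2 (Real.log_nonneg (by exact_mod_cast N.factorial_pos)) (by positivity)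
  have h4 : (x ^ (d + m + 1))⁻¹ * x ^ d = x⁻¹ * (x ^ m)⁻¹ := by
    rw [pow_add, pow_add]; field_simp
  rw [h4] at h3
  have h5 : 4 * x⁻¹ ≤ 1 := by rw [← div_eq_mul_inv, div_le_one hx0]; exact hx
  have h6 : 0 ≤ (x ^ m)⁻¹ := by positivity
  nlinarith

theorem negligible_of_eventually_le {f : ℕ → ℝ} (hf : ∀ k, 0 ≤ f k)
    (h : ∀ m : ℕ, ∀ᶠ k : ℕ in atTop, f k ≤ ((k : ℝ) ^ m)⁻¹) : Negligible f := by
  intro m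
  refine squeeze_zero' (Eventually.of_forall fun k => mul_nonneg (by positivity) (hf k)) ?_
    tendsto_inv_atTop_nhds_zero_nat
  filter_upwards [h (m + 1), eventually_gt_atTop 0] with k hk hk0
  have hk0' : (0 : ℝ) < k := by exact_mod_cast hk0
  calc (k : ℝ) ^ m * f k ≤ (k : ℝ) ^ m * ((k : ℝ) ^ (m + 1))⁻¹ :=
        mul_le_mul_of_nonneg_left hk (by positivity)
    _ = (k : ℝ)⁻¹ := by rw [pow_succ]; field_simp

/-- For every exponent there are parameters with which the mixing bound applies to all large
values of the security parameter. -/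
theorem exists_mixing_parameters {N n L : ℕ → ℕ} (hn : ∀ k, 0 < n k)
    (hN : ∃ p : Polynomial ℕ, ∀ k, N k ≤ p.eval k)
    (hload : (fun k : ℕ => Real.logb 2 (k : ℝ) ^ 2) =O[atTop] fun k => (N k : ℝ) / (n k : ℝ))
    (hL : (fun k : ℕ => Real.logb 2 (k : ℝ) ^ 2) =O[atTop] fun k => (L k : ℝ)) (m : ℕ) :
    ∃ (r : ℕ) (κ : ℕ → ℝ), 20 ≤ r ∧ ∀ᶠ k : ℕ in atTop, 0 ≤ κ k ∧ κ k ≤ 1 / 2 ∧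
      κ k * Real.log (N k) ≤ Real.log r - 3 ∧ 4 * r * (n k + 1) ≤ N k ∧ 1 ≤ L k ∧
      4 * Real.sqrt ((1 - κ k / 4) ^ (L k - 1) * Real.log ((N k).factorial : ℝ)) ≤
        ((k : ℝ) ^ m)⁻¹ := by
  obtain ⟨p, hp⟩ := hN
  obtain ⟨d, hd, hpd⟩ := exists_pow_bound_of_polynomial p
  obtain ⟨C₁, hC₁, h₁⟩ := exists_pos_log_sq_le (fun k => by positivity) hload
  obtain ⟨C₂, hC₂, h₂⟩ := exists_pos_log_sq_le (fun k => Nat.cast_nonneg _) hL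
  have hd0 : (0 : ℝ) < d := by exact_mod_cast hd
  -- Chosen so that `κ = K / (d * log k)` meets the hypothesis of `mixing_bound_le`, using `log² k ≤
  -- C₂ * L ≤ 2 * C₂ * (L - 1)`.
  set K : ℝ := 2 * C₂ * d * (8 * ((d : ℝ) + m + 1)) with hK
  have hK0 : 0 ≤ K := by positivity
  have hlog : Tendsto (fun k : ℕ => Real.log k) atTop atTop :=
    Real.tendsto_log_atTop.comp tendsto_natCast_atTop_atTop
  have hlogsq : Tendsto (fun k : ℕ => Real.log k ^ 2) atTop atTop :=
    (tendsto_pow_atTop two_ne_zero).comp hlog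
  -- Since `κ * log N ≤ K`, the block size `r` can be constant in `k`; it depends on `m` through
  -- `K`.
  obtain ⟨r, hr, hr20⟩ := ((hlog.eventually_ge_atTop (K + 3)).and (eventually_ge_atTop 20)).exists
  refine ⟨r, fun k => K / (d * Real.log k), hr20, ?_⟩
  filter_upwards [h₁, h₂, hpd, hlog.eventually_ge_atTop 1, hlog.eventually_ge_atTop (2 * K / d),
    hlogsq.eventually_ge_atTop (C₁ * (8 * r)), hlogsq.eventually_ge_atTop (2 * C₂),
    eventually_ge_atTop 4] with k e₁ e₂ ed el1 el2 es1 es2 hk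
  have hNk : (N k : ℝ) ≤ (k : ℝ) ^ d := by exact_mod_cast (hp k).trans ed
  have hlk : 0 < Real.log k := by linarith
  have hκ0 : 0 ≤ K / (d * Real.log k) := by positivity
  have hκ1 : K / (d * Real.log k) ≤ 1 / 2 := by
    rw [div_le_iff₀ (by positivity)]
    rw [div_le_iff₀ hd0] at el2
    linarith
  have hlogN : Real.log (N k) ≤ d * Real.log k := by
    rcases Nat.eq_zero_or_pos (N k) with h0 | h0
    · rw [h0]; simp; positivity
    · rw [← Real.log_pow]
      exact Real.log_le_log (by exact_mod_cast h0) hNk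
  have hn0 : (0 : ℝ) < n k := by exact_mod_cast hn k
  have hL1 : 2 ≤ (L k : ℝ) := by
    have : C₂ * 2 ≤ C₂ * L k := by linarith
    exact le_of_mul_le_mul_left this hC₂
  have hL1' : 1 ≤ L k := by
    have : (1 : ℝ) ≤ L k := by linarith
    exact_mod_cast this
  refine ⟨hκ0, hκ1, ?_, ?_, hL1', ?_⟩
  · calc K / (d * Real.log k) * Real.log (N k) ≤ K / (d * Real.log k) * (d * Real.log k) :=
          mul_le_mul_of_nonneg_left hlogN hκ0
      _ = K := by field_simp
      _ ≤ _ := by linarith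
  · have h3 : 8 * (r : ℝ) ≤ N k / n k := le_of_mul_le_mul_left (es1.trans e₁) hC₁
    rw [le_div_iff₀ hn0] at h3
    have h4 : 8 * r * n k ≤ N k := by exact_mod_cast h3
    have h5 : r * 1 ≤ r * n k := Nat.mul_le_mul_left r (hn k)
    nlinarith
  · refine mixing_bound_le (by exact_mod_cast hk) hNk hL1' hκ1 ?_
    rw [div_mul_eq_mul_div, le_div_iff₀ (by positivity), hK]
    have h5 : Real.log k ^ 2 ≤ 2 * C₂ * ((L k : ℝ) - 1) := by nlinarith
    have h6 := mul_le_mul_of_nonneg_left h5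
      (show 0 ≤ d * (8 * ((d : ℝ) + m + 1)) by positivity)
    nlinarith

end Asymptotics

/-- The protocol is statistically private: by contraction of entropy, the traffic volumes hardly
depend on who receives which onion. -/
theorem mainTheorem3 (N L : ℕ → ℕ) (M : ℕ → Type u)
    (servers : ∀ k, Finset (Fin (N k))) (hservers : ∀ k, (servers k).Nonempty)
    (hN : ∃ p : Polynomial ℕ, ∀ k, N k ≤ p.eval k)
    (hload : (fun k : ℕ => Real.logb 2 (k : ℝ) ^ 2) =O[atTop]
      fun k : ℕ => (N k : ℝ) / ((servers k).card : ℝ))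
    (hL : (fun k : ℕ => Real.logb 2 (k : ℝ) ^ 2) =O[atTop] fun k : ℕ => (L k : ℝ)) :
    StatisticallyPrivateFromNetwork.{u, v} (onionProtocol N L M servers hservers) := by
  intro A σ₀ σ₁
  refine negligible_of_eventually_le (fun k => statDist_nonneg _ _) fun m => ?_
  obtain ⟨r, κ, hr, h⟩ := exists_mixing_parameters
    (fun k => Finset.card_pos.2 (hservers k)) hN hload hL m
  filter_upwards [h] with k hk
  obtain ⟨hκ0, hκ1, hκ, hNr, hL1, hb⟩ := hk
  have : Nonempty (servers k) := (hservers k).to_subtype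
  exact statDist_prod_le _ _ (A.law k) fun E hE =>
    (abs_traffic_real_sub_le hr hκ0 hκ1 hκ hNr hL1 (σ₀ k) (σ₁ k) hE).trans hb
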